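/- A permutation $\pi$ of length $n$ is plotted at the points $(i,\pi(i))$. It is \emph{simple} if its only contiguous blocks $\pi(i)\pi(i+1)\cdots\pi(j)$ whose values form a contiguous set of integers are the singletons and $\pi$ itself, and $\operatorname{Av}(2341,4123,3412)$ is the class of permutations containing none of the patterns $2341$, $4123$, $3412$. An entry is a l-r max if it exceeds all entries to its left, and a r-l min if it is smaller than all entries to its right. If $(x,y)$ and $(x',y')$, with $x<x'$, are consecutive l-r maxes, then $(x',y)$ is an inflection of the l-r max path; if they are consecutive r-l mins, then $(x,y')$ is an inflection of the r-l min path. Suppose the inflections form an increasing sequence $p_1,\dots,p_N$ (both coordinates increasing), and put $p_0=(0,0)$, $p_{N+1}=(n+1,n+1)$. For $0\le c,r\le N$ let the cell in column $c$ and row $r$ be the set of entries strictly between the vertical lines through $p_c$ and $p_{c+1}$ and strictly between the horizontal lines through $p_r$ and $p_{r+1}$. The \emph{corner cells} (those that abut a l-r max or a r-l min) are, in order, $C_0,\dots,C_{N+1}$, where $C_0$ is the cell in column $0$ and row $0$, $C_{N+1}$ is the cell in column $N$ and row $N$, and for $1\le k\le N$ the cell $C_k$ is the one in column $k$ and row $k-1$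 if $p_k$ is on the l-r max path, and the one in column $k-1$ and row $k$ if $p_k$ is on the r-l min path. For $1\le k<N$ the \emph{central cell} $S_k$, which lies between the adjacent corner cells $C_k$ and $C_{k+1}$, is the cell in column $k$ and row $k$. Two consecutive corner cells $A=C_k$, $B=C_{k+1}$ \emph{interlace as a parallel alternation} if, for some $m\ge 1$, they are decreasing sequences $a_1,\dots,a_m$ and $b_1,\dots,b_m$ (listed from left to right) such that either $A$ is entirely to the left of $B$ and the entries listed by decreasing value are $b_1,a_1,b_2,a_2,\dots,b_m,a_m$, or $A$ is entirely below $B$ and the entries listed from left to right are $a_1,b_1,a_2,b_2,\dots,a_m,b_m$. \textbf{Theorem.} A simple permutation $\pi$ of length greater than $2$ lies in $\operatorname{Av}(2341,4123,3412)$ if and only if it satisfies the following five conditions. (a) The inflections form an increasing sequence in which the inflections of the l-r max path alternate with the inflections of the r-l min path. (b) The entries in each corner cell are decreasing. (c) Every two consecutive corner cells either together form a decreasing sequence or interlace as a parallel alternation. (d) Every non-empty corner cell interlaces with either the previous or the next corner cell, but not with both. (e) Every central cell contains at most one entry. It is empty if its two adjacent corner cells interlace; otherwise these two cells together with the central cell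 form a decreasing sequence. -/

import Mathlib

/-!  Permutations of length `n` are elements `π` of `Equiv.Perm (Fin n)`.  The entry in position `i`
is plotted at the Cartesian point `(xc i, yc π i)`, whose coordinates run through `1, …, n`. -/

namespace PermClass

variable {n : ℕ}

/-- `π` contains the pattern `w` (a word with distinct letters): some subsequence of `π` is order
isomorphic to `w`. -/
def Contains (π : Equiv.Perm (Fin n)) {k : ℕ} (w : Fin k → ℕ) : Prop :=
  ∃ f : Fin k → Fin n, StrictMono f ∧ ∀ a b, π (f a) < π (f b) ↔ w a < w b

/-- The class `Av(2341, 4123, 3412)`. -/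
def InAv (π : Equiv.Perm (Fin n)) : Prop :=
  ¬ Contains π ![2, 3, 4, 1] ∧ ¬ Contains π ![4, 1, 2, 3] ∧ ¬ Contains π ![3, 4, 1, 2]

/-- The contiguous block of positions `i, …, j` is an interval of `π`: its values are exactly a
contiguous set of integers. -/
def IsInterval (π : Equiv.Perm (Fin n)) (i j : Fin n) : Prop :=
  i ≤ j ∧ ∃ u v : Fin n, (Finset.Icc i j).image π = Finset.Icc u v

/-- `π` is simple: every interval is a singleton or all of `π`. -/
def IsSimple (π : Equiv.Perm (Fin n)) : Prop :=
  ∀ i j : Fin n, IsInterval π i j → i = j ∨ Finset.Icc i j = Finset.univ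

/-- Horizontal coordinate of the entry in position `i`. -/
def xc (i : Fin n) : ℕ := (i : ℕ) + 1

/-- Vertical coordinate of the entry in position `i`. -/
def yc (π : Equiv.Perm (Fin n)) (i : Fin n) : ℕ := (π i : ℕ) + 1

/-- The entry in position `j` is a left-to-right maximum. -/
def IsLRMax (π : Equiv.Perm (Fin n)) (j : Fin n) : Prop := ∀ i, i < j → π i < π j

/-- The entry in position `j` is a right-to-left minimum. -/
def IsRLMin (π : Equiv.Perm (Fin n)) (j : Fin n) : Prop := ∀ k, j < k → π j < π k

/-- `q` is an inflection of the l-r max path.  That path runs horizontally from each l-r max to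
the column of the next l-r max, turns there (the inflection) and goes up to that l-r max. -/
def IsMaxInflection (π : Equiv.Perm (Fin n)) (q : ℕ × ℕ) : Prop :=
  ∃ i j : Fin n, IsLRMax π i ∧ IsLRMax π j ∧ i < j ∧ (∀ k, i < k → k < j → ¬ IsLRMax π k) ∧
    q = (xc j, yc π i)

/-- `q` is an inflection of the r-l min path.  That path runs vertically from each r-l min to
the row of the next r-l min, turns there (the inflection) and goes right to that r-l min. -/
def IsMinInflection (π : Equiv.Perm (Fin n)) (q : ℕ × ℕ) : Prop :=
  ∃ i j : Fin n, IsRLMin π i ∧ IsRLMin π j ∧ i < j ∧ (∀ k, i < k → k < j → ¬ IsRLMin π k) ∧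
    q = (xc i, yc π j)

/-- Condition (a), with the listing made explicit: `p 1, …, p N` are all the inflections of `π`,
they form an increasing sequence (both coordinates increase), and inflections of the l-r max path
alternate with inflections of the r-l min path.  The points `p 0 = (0, 0)` and
`p (N + 1) = (n + 1, n + 1)` are the corners of a frame around the diagram. -/
structure AlternatingInflections (π : Equiv.Perm (Fin n)) (N : ℕ) (p : ℕ → ℕ × ℕ) : Prop where
  first : p 0 = (0, 0)
  last : p (N + 1) = (n + 1, n + 1)
  increasing : ∀ k, k ≤ N → (p k).1 < (p (k + 1)).1 ∧ (p k).2 < (p (k + 1)).2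
  complete : ∀ q, (IsMaxInflection π q ∨ IsMinInflection π q) ↔ ∃ k, 1 ≤ k ∧ k ≤ N ∧ p k = q
  alternate : ∀ k, 1 ≤ k → k < N → (IsMaxInflection π (p k) ↔ IsMinInflection π (p (k + 1)))

/-- The entries (given by their positions) in the grid cell in column `c` and row `r`: the open
rectangle between the vertical lines through `p c` and `p (c + 1)` and between the horizontal
lines through `p r` and `p (r + 1)`. -/
def cell (π : Equiv.Perm (Fin n)) (p : ℕ → ℕ × ℕ) (c r : ℕ) : Finset (Fin n) :=
  Finset.univ.filter fun i =>
    (p c).1 < xc i ∧ xc i < (p (c + 1)).1 ∧ (p r).2 < yc π i ∧ yc π i < (p (r + 1)).2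

open Classical in
/-- The corner cells, those which abut a l-r max or a r-l min, in their order along the diagram;
the index `k` runs through `0, …, N + 1`.  The first one is the lower left cell of the grid and the
last one is the upper right cell.  If `1 ≤ k ≤ N` and `p k` lies on the l-r max path, then the
`k`-th corner cell is the cell diagonally below and to the right of `p k`; the r-l min of the
diagram which is between (on its path) the inflections of the r-l min path before and after `p k`
is its lower right corner.  If `p k` lies on the r-l min path, it is the cell diagonally above and
to the left of `p k`, whose upper left corner is a l-r max. -/
noncomputable def cornerCell (π : Equiv.Perm (Fin n)) (N : ℕ) (p : ℕ → ℕ × ℕ) (k : ℕ) :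
    Finset (Fin n) :=
  if k = 0 then cell π p 0 0
  else if k = N + 1 then cell π p N N
  else if IsMaxInflection π (p k) then cell π p k (k - 1)
  else cell π p (k - 1) k

/-- The central cells: the rectangle with opposite corners `p k` and `p (k + 1)`, for
`1 ≤ k < N`.  It lies between the corner cells with indices `k` and `k + 1`. -/
def centralCell (π : Equiv.Perm (Fin n)) (p : ℕ → ℕ × ℕ) (k : ℕ) : Finset (Fin n) :=
  cell π p k k

/-- The entries of `π` in the positions of `S` form a decreasing sequence. -/
def Decreasing (π : Equiv.Perm (Fin n)) (S : Finset (Fin n)) : Prop :=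
  ∀ i ∈ S, ∀ j ∈ S, i < j → π j < π i

/-- The entries in `A` and `B` interlace as a parallel alternation: both are non-empty decreasing
sequences `a 0, …, a (m - 1)` and `b 0, …, b (m - 1)` of the same length `m`, and together they
are order isomorphic to one of the two `123`-avoiding parallel alternations of length `2 * m`
cut into its two halves.
Either `A` is to the left of `B` and the values, read downwards, alternate as
`b 0, a 0, b 1, a 1, …`; or `A` is below `B` and the positions, read from left to right, alternate
as `a 0, b 0, a 1, b 1, …`. -/
def Interlace (π : Equiv.Perm (Fin n)) (A B : Finset (Fin n)) : Prop :=
  ∃ m : ℕ, 1 ≤ m ∧ ∃ a b : Fin m → Fin n,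
    Finset.univ.image a = A ∧ Finset.univ.image b = B ∧
    StrictMono a ∧ StrictMono b ∧ StrictAnti (π ∘ a) ∧ StrictAnti (π ∘ b) ∧
    (((∀ s t, a s < b t) ∧ (∀ s t, π (a s) < π (b t) ↔ t ≤ s)) ∨
      ((∀ s t, π (a s) < π (b t)) ∧ (∀ s t, a s < b t ↔ s ≤ t)))

/-- Condition (b): the corner cells are decreasing. -/
def CornersDecreasing (π : Equiv.Perm (Fin n)) (N : ℕ) (p : ℕ → ℕ × ℕ) : Prop :=
  ∀ k, k ≤ N + 1 → Decreasing π (cornerCell π N p k)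

/-- Condition (c): two consecutive corner cells together form a decreasing sequence, or they
interlace as a parallel alternation. -/
def ConsecutiveCorners (π : Equiv.Perm (Fin n)) (N : ℕ) (p : ℕ → ℕ × ℕ) : Prop :=
  ∀ k, k ≤ N → Decreasing π (cornerCell π N p k ∪ cornerCell π N p (k + 1)) ∨
    Interlace π (cornerCell π N p k) (cornerCell π N p (k + 1))

/-- Condition (d): a non-empty corner cell interlaces with the previous corner cell (if there is
one) or with the next corner cell (if there is one), but not with both. -/
def CornersInterlaceOnce (π : Equiv.Perm (Fin n)) (N : ℕ) (p : ℕ → ℕ × ℕ) : Prop :=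
  ∀ k, k ≤ N + 1 → (cornerCell π N p k).Nonempty →
    Xor (1 ≤ k ∧ Interlace π (cornerCell π N p (k - 1)) (cornerCell π N p k))
      (k ≤ N ∧ Interlace π (cornerCell π N p k) (cornerCell π N p (k + 1)))

/-- Condition (e): a central cell has at most one entry; it is empty if the two adjacent corner
cells interlace, and otherwise these two corner cells and the central cell together form a
decreasing sequence. -/
def CentralCells (π : Equiv.Perm (Fin n)) (N : ℕ) (p : ℕ → ℕ × ℕ) : Prop :=
  ∀ k, 1 ≤ k → k < N →
    (centralCell π p k).card ≤ 1 ∧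
    (Interlace π (cornerCell π N p k) (cornerCell π N p (k + 1)) → centralCell π p k = ∅) ∧
    (¬ Interlace π (cornerCell π N p k) (cornerCell π N p (k + 1)) →
      Decreasing π (cornerCell π N p k ∪ centralCell π p k ∪ cornerCell π N p (k + 1)))

end PermClass

/-! All geometry takes place in a set of points whose coordinates `X` and `Y` play symmetric roles:
reflection in the diagonal exchanges 2341 with 4123, fixes 3412, and exchanges l-r maxes with r-l
mins. Each geometric lemma is therefore proved for one kind of corner cell and carried to the other
kind by a `swap` lemma.

In a simple avoider the inflections form a chain, because an incomparable pair would give a 3412 or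
a decomposition as a direct sum (`SimplePoints.min_max_comparable`), and the two kinds alternate
(`SimplePoints.exists_max_between`). From such a chain one obtains a zigzag of l-r maxes and r-l
mins `e 0, …, e (N + 1)` whose coordinates bound the corner and central cells
(`InflectionSequence.exists_staircase`). The strip between the adjacent points `e k` and `e (k + 1)`
contains only entries of `C k`, `S k` and `C (k + 1)` (`Staircase.rect_cases`). This locality
carries both directions.

Avoidance implies the conditions: the central notion is `Link`, an increasing pair from `C k` to `C
(k + 1)`. Corner points complete misplaced increasing pairs to forbidden patterns, so corner cells
decrease, central entries decrease with their neighbours, and two successive links are impossible.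
Simplicity gives the rest: an entry separating two successive entries of a cell can only come from
the linked cell. Hence linked cells alternate, every non-empty corner cell has a link, and a central
cell cannot hold two entries.

The conditions imply avoidance: a supposed pattern is compared with a corner point to the lower
right of its last letter. Its increasing pairs then fall into strips, where
`Staircase.corner_of_inc` puts them into interlacing consecutive corner cells. Either one cell takes
part in two interlacings or the positions contradict each other. Simplicity serves here only to
build the staircase. -/

namespace PermClass

/-! ### Avoidance and simplicity for point sets, symmetric in the two coordinates. -/

section Points

variable {α : Type*}

/-- `b` is above and to the right of `a`. -/
def Inc (X Y : α → ℤ) (a b : α) : Prop := X a < X b ∧ Y a < Y b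

/-- The points with coordinates `X`, `Y` avoid the patterns `2341`, `4123`, `3412`. -/
structure Avoids (X Y : α → ℤ) : Prop where
  no2341 : ∀ u v w z, X u < X v → X v < X w → X w < X z →
    Y z < Y u → Y u < Y v → Y v < Y w → False
  no4123 : ∀ z u v w, X z < X u → X u < X v → X v < X w →
    Y u < Y v → Y v < Y w → Y w < Y z → False
  no3412 : ∀ a b c d, X a < X b → X b < X c → X c < X d →
    Y c < Y d → Y d < Y a → Y a < Y b → False

/-- Inversion exchanges 2341 with 4123 and fixes 3412. -/
theorem Avoids.swap {X Y : α → ℤ} (h : Avoids X Y) : Avoids Y X where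
  no2341 u v w z h1 h2 h3 h4 h5 h6 := h.no4123 z u v w h4 h5 h6 h1 h2 h3
  no4123 z u v w h1 h2 h3 h4 h5 h6 := h.no2341 u v w z h4 h5 h6 h1 h2 h3
  no3412 a b c d h1 h2 h3 h4 h5 h6 := h.no3412 c d a b h4 h5 h6 h1 h2 h3

/-- The consequences of simplicity: two points are separated by a third one, horizontally or
vertically; the set of points is not a direct sum; no point is extreme to the lower right or to the
upper left. -/
structure SimplePoints (X Y : α → ℤ) : Prop where
  injX : Function.Injective X
  injY : Function.Injective Y
  sep : ∀ a b, a ≠ b → ∃ c, (X a < X c ∧ X c < X b) ∨ (X b < X c ∧ X c < X a) ∨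
    (Y a < Y c ∧ Y c < Y b) ∨ (Y b < Y c ∧ Y c < Y a)
  cut : ∀ P : α → Prop, (∀ a b, P a → ¬ P b → Inc X Y a b) → (∀ a, P a) ∨ ∀ a, ¬ P a
  lowerRight : ∀ z, (∀ a, X a ≤ X z) → (∀ a, Y z ≤ Y a) → False
  upperLeft : ∀ z, (∀ a, X z ≤ X a) → (∀ a, Y a ≤ Y z) → False

theorem SimplePoints.swap {X Y : α → ℤ} (h : SimplePoints X Y) : SimplePoints Y X where
  injX := h.injY
  injY := h.injX
  sep a b hab := by
    obtain ⟨c, hc⟩ := h.sep a b hab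
    exact ⟨c, by tauto⟩
  cut P hP := h.cut P fun a b ha hb => (hP a b ha hb).symm
  lowerRight z h1 h2 := h.upperLeft z h2 h1
  upperLeft z h1 h2 := h.lowerRight z h2 h1

/-! ### Staircases of corner points and the strips between them. -/

/-- The index of the corner point which bounds the `k`-th corner cell on the side of the
previous corner cell. -/
def prv (k : ℕ) : ℕ := if k = 0 then 2 else k - 1

/-- The index of the corner point which bounds the `k`-th corner cell on the side of the
next corner cell. -/
def nxt (N k : ℕ) : ℕ := if k ≤ N then k + 1 else N - 1

/-- No corner point precedes `e 0`; the far side of the first cell is the line through the first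
inflection, and this line passes through `e 2`. -/
theorem prv_zero : prv 0 = 2 := rfl

theorem prv_succ (k : ℕ) : prv (k + 1) = k := by simp [prv]

theorem nxt_of_le {N k : ℕ} (h : k ≤ N) : nxt N k = k + 1 := by simp [nxt, h]

theorem nxt_last (N : ℕ) : nxt N (N + 1) = N - 1 := by simp [nxt]

/-- The part of the description of a staircase which concerns the indices `k` with `σ k`; for them
the `k`-th corner point `e k` is a right-to-left minimum. -/
structure HalfStaircase (X Y : α → ℤ) (N : ℕ) (σ : ℕ → Prop) (e : ℕ → α)
    (C S : ℕ → α → Prop) : Prop where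
  adj : ∀ k, k ≤ N → σ k → X (e (k + 1)) < X (e k) ∧ Y (e k) < Y (e (k + 1))
  inc_two : ∀ k, k + 1 ≤ N → σ k → Inc X Y (e k) (e (k + 2))
  lt_three : ∀ k, k + 2 ≤ N → σ k → X (e k) < X (e (k + 3))
  vacant : ∀ k, k + 1 ≤ N → σ k → ∀ z, X (e k) < X z → Y (e (k + 2)) ≤ Y z
  lowest : ∀ k, k ≤ 1 → σ k → ∀ z, Y (e k) ≤ Y z
  rightmost : ∀ k, N ≤ k → k ≤ N + 1 → σ k → ∀ z, X z ≤ X (e k)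
  corner : ∀ k, k ≤ N + 1 → σ k → ∀ z, C k z ↔
    X (e (nxt N k)) < X z ∧ X z < X (e k) ∧ Y (e k) < Y z ∧ Y z < Y (e (prv k))
  central : ∀ k, k + 2 ≤ N → σ (k + 1) → ∀ z, S (k + 1) z ↔
    X (e (k + 2)) < X z ∧ X z < X (e (k + 1)) ∧ Y (e k) < Y z ∧ Y z < Y (e (k + 3))

/-- The points `e 0, …, e (N + 1)` are alternately left-to-right maxima and right-to-left minima
which form a staircase with corner cells `C k` and central cells `S k`. -/
structure Staircase (X Y : α → ℤ) (N : ℕ) (σ : ℕ → Prop) (e : ℕ → α)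
    (C S : ℕ → α → Prop) : Prop where
  injX : Function.Injective X
  injY : Function.Injective Y
  two_le : 2 ≤ N
  alt : ∀ k, k ≤ N → (σ (k + 1) ↔ ¬ σ k)
  lower : HalfStaircase X Y N σ e C S
  upper : HalfStaircase Y X N (fun k => ¬ σ k) e C S

namespace Staircase

variable {X Y : α → ℤ} {N : ℕ} {σ : ℕ → Prop} {e : ℕ → α} {C S : ℕ → α → Prop}

theorem swap (h : Staircase X Y N σ e C S) : Staircase Y X N (fun k => ¬ σ k) e C S where
  injX := h.injY
  injY := h.injX
  two_le := h.two_le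
  alt k hk := by rw [h.alt k hk]
  lower := h.upper
  upper := by simpa using h.lower

/-- The r-l min path through `e (k - 2)` and `e k` bounds the strip from below, the l-r max path
through `e (k + 1)` and `e (k + 3)` bounds it from above; `lt_three` says that the strip does not
reach beyond these steps. Near the ends, `lowest` and `rightmost` replace the missing points. -/
theorem rect (h : Staircase X Y N σ e C S) {k : ℕ} (hk : k ≤ N) (hs : σ k) {z : α}
    (h1 : X (e (k + 1)) < X z) (h2 : X z < X (e k)) : Y (e k) < Y z ∧ Y z < Y (e (k + 1)) := by
  have hs1 : ¬ σ (k + 1) := by simpa [h.alt k hk] using hs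
  constructor
  · have : Y (e k) ≠ Y z := fun hh => by have := h.injY hh; subst this; omega
    suffices Y (e k) ≤ Y z by omega
    match k, hk, hs, h1 with
    | 0, _, hs, _ => exact h.lower.lowest 0 (by omega) hs z
    | 1, _, hs, _ => exact h.lower.lowest 1 (by omega) hs z
    | k + 2, hk, hs, h1 =>
      have hs' : σ k := by
        have := h.alt (k + 1) (by omega); have := h.alt k (by omega); tauto
      have : X (e k) < X (e (k + 2 + 1)) := h.lower.lt_three k hk hs'
      exact h.lower.vacant k (by omega) hs' z (by omega)
  · have : Y (e (k + 1)) ≠ Y z := fun hh => by have := h.injY hh; subst this; omega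
    by_contra hc
    rcases Nat.lt_or_ge (k + 1) N with hk' | hk'
    · have := h.upper.vacant (k + 1) (by omega) hs1 z (by omega)
      have := h.lower.lt_three k (by omega) hs
      rw [show k + 1 + 2 = k + 3 from rfl] at *
      omega
    · have := h.upper.rightmost (k + 1) hk' (by omega) hs1 z
      omega

theorem mem_corner (h : Staircase X Y N σ e C S) {k : ℕ} (hk : k ≤ N) (hs : σ k) {z : α} :
    C k z ↔ X (e (k + 1)) < X z ∧ X z < X (e k) ∧ Y z < Y (e (prv k)) := by
  rw [h.lower.corner k (by omega) hs z, nxt_of_le hk]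
  constructor
  · tauto
  · rintro ⟨h1, h2, h3⟩
    exact ⟨h1, h2, (h.rect hk hs h1 h2).1, h3⟩

theorem mem_corner_succ (h : Staircase X Y N σ e C S) {k : ℕ} (hk : k ≤ N) (hs : σ k) {z : α} :
    C (k + 1) z ↔ X (e (k + 1)) < X z ∧ X z < X (e k) ∧ Y (e (nxt N (k + 1))) < Y z := by
  have hs1 : ¬ σ (k + 1) := by simpa [h.alt k hk] using hs
  rw [h.upper.corner (k + 1) (by omega) hs1 z, prv_succ]
  constructor
  · tauto
  · rintro ⟨h1, h2, h3⟩
    exact ⟨h3, (h.rect hk hs h1 h2).2, h1, h2⟩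

/-- For inner `k` this is `lt_three` for `e (k - 1)` and `e (k + 2)`; at both ends the two sides are
the same point. It is what places `C k` below `C (k + 1)`. -/
theorem prv_le_nxt (h : Staircase X Y N σ e C S) {k : ℕ} (hk : k ≤ N) (hs : σ k) :
    Y (e (prv k)) ≤ Y (e (nxt N (k + 1))) := by
  have := h.two_le
  cases k with
  | zero => rw [prv_zero, nxt_of_le (by omega)]
  | succ k =>
    rw [prv_succ]
    rcases Nat.lt_or_ge (k + 1) N with hk' | hk'
    · rw [nxt_of_le (by omega)]
      have hs' : ¬ σ k := by have := h.alt k (by omega); tauto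
      exact (h.upper.lt_three k (by omega) hs').le
    · obtain rfl : N = k + 1 := by omega
      rw [nxt_last, Nat.add_sub_cancel]

theorem corner_lt (h : Staircase X Y N σ e C S) {k : ℕ} (hk : k ≤ N) (hs : σ k) {a b : α}
    (ha : C k a) (hb : C (k + 1) b) : Y a < Y b := by
  have h1 := (h.mem_corner hk hs).1 ha
  have h2 := (h.mem_corner_succ hk hs).1 hb
  have := h.prv_le_nxt hk hs
  omega

/-- A point horizontally between two adjacent corner points is in a cell between them. -/
theorem rect_cases (h : Staircase X Y N σ e C S) {k : ℕ} (hk : k ≤ N) (hs : σ k) {z : α}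
    (h1 : X (e (k + 1)) < X z) (h2 : X z < X (e k)) :
    C k z ∨ C (k + 1) z ∨ (1 ≤ k ∧ k < N ∧ S k z) := by
  rw [h.mem_corner hk hs, h.mem_corner_succ hk hs]
  have hN := h.two_le
  have hr := h.rect hk hs h1 h2
  cases k with
  | zero =>
    rw [prv_zero, nxt_of_le (by omega)]
    have hs2 : σ 2 := by have := h.alt 0 (by omega); have := h.alt 1 (by omega); tauto
    have : Y z ≠ Y (e 2) := fun hh => by
      have := h.injY hh; subst this
      have := h.lower.inc_two 0 (by omega) hs
      have := this.1
      simp only [zero_add] at *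
      omega
    simp only [zero_add, Nat.reduceAdd] at *
    omega
  | succ k =>
    rw [prv_succ]
    have hs' : ¬ σ k := by have := h.alt k (by omega); tauto
    have hne : Y z ≠ Y (e k) := fun hh => by
      have := h.injY hh; subst this
      have := h.upper.inc_two k (by omega) hs'
      have := this.2
      rw [show k + 1 + 1 = k + 2 from rfl] at *
      omega
    rcases Nat.lt_or_ge (k + 1) N with hk' | hk'
    · rw [nxt_of_le (by omega), h.lower.central k (by omega) hs]
      have : Y z ≠ Y (e (k + 3)) := fun hh => by
        have := h.injY hh; subst this
        have := (h.lower.inc_two (k + 1) (by omega) hs).1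
        rw [show k + 1 + 2 = k + 3 from rfl] at *
        omega
      simp only [Nat.add_assoc, Nat.reduceAdd] at *
      omega
    · obtain rfl : N = k + 1 := by omega
      rw [nxt_last, Nat.add_sub_cancel]
      omega

theorem central_mem (h : Staircase X Y N σ e C S) {k : ℕ} (h1 : 1 ≤ k) (hk : k < N) (hs : σ k)
    {z : α} (hz : S k z) : X (e (k + 1)) < X z ∧ X z < X (e k) ∧
      (∀ a, C k a → Y a < Y z) ∧ ∀ b, C (k + 1) b → Y z < Y b := by
  obtain ⟨k, rfl⟩ : ∃ j, k = j + 1 := ⟨k - 1, by omega⟩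
  have hz := (h.lower.central k (by omega) hs z).1 hz
  refine ⟨hz.1, hz.2.1, fun a ha => ?_, fun b hb => ?_⟩
  · have := (h.mem_corner (by omega) hs).1 ha
    rw [prv_succ] at this
    omega
  · have := (h.mem_corner_succ (by omega) hs).1 hb
    rw [nxt_of_le (by omega)] at this
    simp only [Nat.add_assoc, Nat.reduceAdd] at *
    omega

end Staircase

/-! ### Avoidance and simplicity determine the contents of the cells. -/

/-- Some entry of the `k`-th corner cell is below and to the left of some entry of the next one. -/
def Link (X Y : α → ℤ) (C : ℕ → α → Prop) (k : ℕ) : Prop :=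
  ∃ a b, C k a ∧ C (k + 1) b ∧ Inc X Y a b

theorem link_swap {X Y : α → ℤ} {C : ℕ → α → Prop} {k : ℕ} : Link Y X C k ↔ Link X Y C k := by
  simp only [Link, Inc, and_comm]

/-- Ordered by `X`, the elements of `A` and `B` alternate, beginning in `A` and ending in `B`. -/
structure Alternate (X : α → ℤ) (A B : α → Prop) : Prop where
  left : ∀ a a', A a → A a' → X a < X a' → ∃ b, B b ∧ X a < X b ∧ X b < X a'
  after : ∀ a, A a → ∃ b, B b ∧ X a < X b
  right : ∀ b b', B b → B b' → X b < X b' → ∃ a, A a ∧ X b < X a ∧ X a < X b'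
  before : ∀ b, B b → ∃ a, A a ∧ X a < X b

namespace Staircase

variable {X Y : α → ℤ} {N : ℕ} {σ : ℕ → Prop} {e : ℕ → α} {C S : ℕ → α → Prop}

/-- If `z` is to the upper right of `s`, then `e (k - 1)`, `s`, `z`, `e k` form 2341. If `z` is in
`C k`, to the lower left of `s`, then `e (k + 1)`, `z`, `s`, `e (k + 2)` form 4123. -/
theorem central_not_inc_of_lower (h : Staircase X Y N σ e C S) (av : Avoids X Y) {k : ℕ}
    (h1 : 1 ≤ k) (hk : k < N) (hs : σ k) {s z : α} (hS : S k s)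
    (hz : C k z ∨ S k z ∨ C (k + 1) z) : ¬ Inc X Y s z ∧ ¬ Inc X Y z s := by
  have hm := h.central_mem h1 hk hs hS
  obtain ⟨k, rfl⟩ : ∃ j, k = j + 1 := ⟨k - 1, by omega⟩
  have hs0 : ¬ σ k := by have := h.alt k (by omega); tauto
  have hs2 : ¬ σ (k + 1 + 1) := by have := h.alt (k + 1) (by omega); tauto
  have hY := (h.lower.central k (by omega) hs s).1 hS
  have key : ∀ s z, S (k + 1) s → (X z < X (e (k + 1))) → ¬ Inc X Y s z := by
    intro s z hS hz hi
    have hY := (h.lower.central k (by omega) hs s).1 hS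
    have i1 := h.upper.inc_two k (by omega) hs0
    have i2 := h.upper.adj k (by omega) hs0
    exact av.no2341 (e k) s z (e (k + 1)) (by have := i1.2; omega) hi.1 hz i2.1 (by omega) hi.2
  rcases hz with hz | hz | hz
  · have i0 := h.mem_corner (by omega) hs |>.1 hz
    have i3 := hm.2.2.1 z hz
    refine ⟨fun hi => by have := hi.2; omega, fun hi => ?_⟩
    have i1 := h.lower.inc_two (k + 1) (by omega) hs
    have i2 := h.upper.adj (k + 2) (by omega) hs2
    exact av.no4123 (e (k + 2)) z s (e (k + 3)) i0.1 hi.1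
      (by have := i1.1; simp only [Nat.add_assoc, Nat.reduceAdd] at *; omega) hi.2 (by omega) i2.1
  · have hz' := (h.lower.central k (by omega) hs z).1 hz
    exact ⟨key s z hS hz'.2.1, key z s hz hY.2.1⟩
  · have i0 := h.mem_corner_succ (by omega) hs |>.1 hz
    have i3 := hm.2.2.2 z hz
    exact ⟨key s z hS i0.2.1, fun hi => by have := hi.2; omega⟩

/-- An entry of a central cell forms a decreasing sequence with every other entry of this cell and
of the two adjacent corner cells. -/
theorem central_not_inc (h : Staircase X Y N σ e C S) (av : Avoids X Y) {k : ℕ}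
    (h1 : 1 ≤ k) (hk : k < N) {s z : α} (hS : S k s)
    (hz : C k z ∨ S k z ∨ C (k + 1) z) : ¬ Inc X Y s z ∧ ¬ Inc X Y z s := by
  by_cases hs : σ k
  · exact h.central_not_inc_of_lower av h1 hk hs hS hz
  · have := h.swap.central_not_inc_of_lower av.swap h1 hk hs hS hz
    exact ⟨fun hi => this.1 hi.symm, fun hi => this.2 hi.symm⟩

/-- In an inner cell an increasing pair forms 3412 with the l-r maxes `e (k - 1)` and `e (k + 1)` on
its upper left. An end cell has only one such neighbour; there a further r-l min completes a 4123.
-/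
theorem corner_not_inc_of_lower (h : Staircase X Y N σ e C S) (av : Avoids X Y) {k : ℕ}
    (hk : k ≤ N + 1) (hs : σ k) {a b : α} (ha : C k a) (hb : C k b) : ¬ Inc X Y a b := by
  intro hi
  have hN := h.two_le
  have ha := (h.lower.corner k hk hs a).1 ha
  have hb := (h.lower.corner k hk hs b).1 hb
  have hX := hi.1
  have hY := hi.2
  rcases Nat.lt_or_ge N k with hk' | hk'
  · obtain rfl : k = N + 1 := by omega
    obtain ⟨j, rfl⟩ : ∃ j, N = j + 1 := ⟨N - 1, by omega⟩
    rw [nxt_last, prv_succ, Nat.add_sub_cancel] at ha hb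
    have hs0 : σ j := by
      have := h.alt (j + 1) (by omega); have := h.alt j (by omega); tauto
    have i1 := h.lower.adj j (by omega) hs0
    have i2 := (h.lower.inc_two j (by omega) hs0).2
    simp only [Nat.add_assoc, Nat.reduceAdd] at *
    exact av.no4123 (e (j + 1)) (e j) a b (by omega) (by omega) hX (by omega) hY (by omega)
  rw [nxt_of_le hk'] at ha hb
  cases k with
  | zero =>
    rw [prv_zero] at ha hb
    have hs1 : ¬ σ 1 := by have := h.alt 0 (by omega); tauto
    have i1 := (h.lower.inc_two 0 (by omega) hs).1
    have i2 := (h.upper.adj 1 (by omega) hs1).1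
    simp only [zero_add, Nat.reduceAdd] at *
    exact av.no4123 (e 1) a b (e 2) (by omega) hX (by omega) hY (by omega) (by omega)
  | succ k =>
    rw [prv_succ] at ha hb
    have hs0 : ¬ σ k := by have := h.alt k (by omega); tauto
    have i1 := h.upper.inc_two k (by omega) hs0
    exact av.no3412 (e k) (e (k + 2)) a b i1.2 ha.1 hX hY hb.2.2.2 i1.1

theorem corner_not_inc (h : Staircase X Y N σ e C S) (av : Avoids X Y) {k : ℕ}
    (hk : k ≤ N + 1) {a b : α} (ha : C k a) (hb : C k b) : ¬ Inc X Y a b := by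
  by_cases hs : σ k
  · exact h.corner_not_inc_of_lower av hk hs ha hb
  · exact fun hi => h.swap.corner_not_inc_of_lower av.swap hk hs ha hb hi.symm

/-- Since `C (k + 1)` decreases, the left one of its two linked entries takes part in both links. It
yields an increasing triple through the three cells, which the r-l min `e (k + 1)` completes to
2341. -/
theorem not_link_of_lower (h : Staircase X Y N σ e C S) (av : Avoids X Y) {k : ℕ}
    (hk : k + 1 ≤ N) (hs : σ (k + 1)) (h1 : Link X Y C k) : ¬ Link X Y C (k + 1) := by
  rintro ⟨a, b, ha, hb, hab⟩
  obtain ⟨c, a', hc, ha', hca⟩ := h1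
  have hs0 : ¬ σ k := by have := h.alt k (by omega); tauto
  have hb' := (h.mem_corner_succ hk hs).1 hb
  have hc' := (h.swap.mem_corner (k := k) (by omega) hs0).1 hc
  rcases lt_or_ge (X a') (X a) with hX | hX
  · exact av.no2341 c a' b (e (k + 1)) hca.1 (hX.trans hab.1) hb'.2.1 hc'.1 hca.2
      (h.corner_lt hk hs ha' hb)
  · have : Y a' ≤ Y a := by
      rcases hX.eq_or_lt with hX | hX
      · rw [h.injX hX]
      · by_contra hlt
        exact h.corner_not_inc av (by omega) ha ha' ⟨hX, by omega⟩
    exact av.no2341 c a b (e (k + 1)) (h.swap.corner_lt (k := k) (by omega) hs0 hc ha) hab.1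
      hb'.2.1 hc'.1 (hca.2.trans_le this) hab.2

theorem not_link (h : Staircase X Y N σ e C S) (av : Avoids X Y) {k : ℕ}
    (hk : k + 1 ≤ N) (h1 : Link X Y C k) : ¬ Link X Y C (k + 1) := by
  by_cases hs : σ (k + 1)
  · exact h.not_link_of_lower av hk hs h1
  · rw [← link_swap] at h1 ⊢
    exact h.swap.not_link_of_lower av.swap hk hs h1

/-- In the horizontal strip of `e (k - 1)` and `e k`, the entry `z` could otherwise be only in `C (k
- 1)`, where it would give a link, or in `S (k - 1)`, which lies left of `C k` and decreases with
it. -/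
theorem corner_of_vertically_between (h : Staircase X Y N σ e C S) (av : Avoids X Y) {k : ℕ}
    (hk : k ≤ N + 1) (hs : σ k) (hl : ∀ j, j + 1 = k → ¬ Link X Y C j) {a z : α} (ha : C k a)
    (h1 : Y (e k) < Y z) (h2 : Y z < Y a) : C k z := by
  have hN := h.two_le
  have ha' := (h.lower.corner k hk hs a).1 ha
  cases k with
  | zero =>
    rw [prv_zero] at ha'
    rw [h.mem_corner (by omega) hs, prv_zero]
    have hs1 : ¬ σ 1 := by have := h.alt 0 (by omega); tauto
    have i2 := (h.upper.adj 1 (by omega) hs1).1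
    have i3 := h.upper.lowest 1 (by omega) hs1 z
    have i4 := h.lower.vacant 0 (by omega) hs z
    have i5 : X z ≠ X (e 0) := fun hh => by have := h.injX hh; subst this; omega
    have i6 : X z ≠ X (e 1) := fun hh => by
      have := h.injX hh; subst this; simp only [Nat.reduceAdd] at *; omega
    simp only [zero_add, Nat.reduceAdd] at *
    omega
  | succ k =>
    rw [prv_succ] at ha'
    have hs0 : ¬ σ k := by have := h.alt k (by omega); tauto
    rcases h.swap.rect_cases (k := k) (by omega) hs0 (z := z) h1 (by omega) with hz | hz | hz
    · exact absurd ⟨z, a, hz, ha, h.swap.corner_lt (k := k) (by omega) hs0 hz ha, h2⟩ (hl k rfl)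
    · exact hz
    · have hm := h.swap.central_mem hz.1 hz.2.1 hs0 hz.2.2
      exact absurd ⟨hm.2.2.2 a ha, h2⟩
        (h.central_not_inc av hz.1 hz.2.1 hz.2.2 (Or.inr (Or.inr ha))).1

theorem corner_succ_of_vertically_between (h : Staircase X Y N σ e C S) (av : Avoids X Y)
    {k : ℕ} (hk : k ≤ N) (hs : σ k) (hl : k + 1 ≤ N → ¬ Link X Y C (k + 1)) {b z : α}
    (hb : C (k + 1) b) (h1 : Y z < Y (e (k + 1))) (h2 : Y b < Y z) : C (k + 1) z := by
  have hN := h.two_le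
  have hb' := (h.mem_corner_succ hk hs).1 hb
  have hs1 : ¬ σ (k + 1) := by have := h.alt k (by omega); tauto
  rcases Nat.lt_or_ge k N with hk' | hk'
  · rw [nxt_of_le (by omega)] at hb'
    rcases h.swap.rect_cases (k := k + 1) (by omega) hs1 (z := z) (by omega) h1 with hz | hz | hz
    · exact hz
    · exact absurd ⟨b, z, hb, hz, h.swap.corner_lt (k := k + 1) (by omega) hs1 hb hz, h2⟩
        (hl (by omega))
    · have hm := h.swap.central_mem hz.1 hz.2.1 hs1 hz.2.2
      exact absurd ⟨hm.2.2.1 b hb, h2⟩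
        (h.central_not_inc av hz.1 hz.2.1 hz.2.2 (Or.inl hb)).2
  · obtain rfl : k = N := by omega
    obtain ⟨j, rfl⟩ : ∃ j, k = j + 1 := ⟨k - 1, by omega⟩
    rw [h.mem_corner_succ hk hs]
    rw [nxt_last, Nat.add_sub_cancel] at *
    have hs0 : ¬ σ j := by have := h.alt j (by omega); tauto
    have i2 := h.upper.adj j (by omega) hs0
    have i3 := h.lower.rightmost (j + 1) (by omega) (by omega) hs z
    have i4 := h.upper.vacant j (by omega) hs0 z (by omega)
    have i5 : X z ≠ X (e (j + 1)) := fun hh => by have := h.injX hh; subst this; omega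
    have i6 : X z ≠ X (e (j + 1 + 1)) := fun hh => by have := h.injX hh; subst this; omega
    simp only [Nat.add_assoc, Nat.reduceAdd] at *
    omega

theorem cases_of_horizontally_between (h : Staircase X Y N σ e C S) (av : Avoids X Y) {k : ℕ}
    (hk : k ≤ N + 1) (hs : σ k) {a z : α} (ha : C k a)
    (h1 : X a < X z) (h2 : X z < X (e k)) : C k z ∨ (k ≤ N ∧ C (k + 1) z) := by
  have hN := h.two_le
  rcases Nat.lt_or_ge N k with hk' | hk'
  · obtain rfl : k = N + 1 := by omega
    obtain ⟨j, rfl⟩ : ∃ j, N = j + 1 := ⟨N - 1, by omega⟩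
    left
    have ha' := (h.lower.corner _ hk hs a).1 ha
    rw [h.lower.corner _ hk hs]
    rw [nxt_last, prv_succ, Nat.add_sub_cancel] at *
    have hs1 : ¬ σ (j + 1) := by have := h.alt (j + 1) (by omega); tauto
    have hs0 : σ j := by have := h.alt j (by omega); tauto
    have i2 := h.lower.adj j (by omega) hs0
    have i3 := h.upper.rightmost (j + 1) (by omega) (by omega) hs1 z
    have i4 := h.lower.vacant j (by omega) hs0 z (by omega)
    have i5 : Y z ≠ Y (e (j + 1)) := fun hh => by have := h.injY hh; subst this; omega
    have i6 : Y z ≠ Y (e (j + 1 + 1)) := fun hh => by have := h.injY hh; subst this; omega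
    simp only [Nat.add_assoc, Nat.reduceAdd] at *
    omega
  · have ha' := (h.mem_corner hk' hs).1 ha
    rcases h.rect_cases hk' hs (z := z) (by omega) h2 with hz | hz | hz
    · exact Or.inl hz
    · exact Or.inr ⟨hk', hz⟩
    · have hm := h.central_mem hz.1 hz.2.1 hs hz.2.2
      exact absurd ⟨h1, hm.2.2.1 a ha⟩
        (h.central_not_inc av hz.1 hz.2.1 hz.2.2 (Or.inl ha)).2

/-- Let `m` be the next element of `C k` to the right of `a`, with `e k` as a sentinel after the
last one. Simplicity separates `a` from `m`. A vertical separator belongs to `C k`, hence is also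
horizontally between them, against the choice of `m`; a horizontal one must be in `C (k + 1)`. -/
theorem separated_by_succ [Finite α] (h : Staircase X Y N σ e C S) (av : Avoids X Y)
    (sp : SimplePoints X Y) {k : ℕ} (hk : k ≤ N + 1) (hs : σ k)
    (hl : ∀ j, j + 1 = k → ¬ Link X Y C j) {a a' : α} (ha : C k a) (ha' : C k a' ∨ a' = e k)
    (hlt : X a < X a') : k ≤ N ∧ ∃ b, C (k + 1) b ∧ X a < X b ∧ X b < X a' := by
  obtain ⟨m, ⟨hm, hm1⟩, hmin⟩ := Set.exists_min_image {z | (C k z ∨ z = e k) ∧ X a < X z} X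
    (Set.toFinite _) ⟨a', ha', hlt⟩
  have hma := hmin a' ⟨ha', hlt⟩
  have hca := (h.lower.corner k hk hs a).1 ha
  have hme : X m ≤ X (e k) ∧ Y (e k) ≤ Y m ∧ Y m < Y a := by
    rcases hm with hm | rfl
    · have := (h.lower.corner k hk hs m).1 hm
      have hi := h.corner_not_inc av hk ha hm
      have : Y m ≠ Y a := fun hh => by have := h.injY hh; subst this; omega
      refine ⟨by omega, by omega, ?_⟩
      by_contra hc
      exact hi ⟨hm1, by omega⟩
    · omega
  obtain ⟨c, hc⟩ := sp.sep a m (by rintro rfl; omega)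
  have hno : ¬ (C k c ∧ X a < X c ∧ X c < X m) := fun hh => by
    have := hmin c ⟨Or.inl hh.1, hh.2.1⟩
    omega
  rcases hc with hc | hc | hc | hc
  · rcases h.cases_of_horizontally_between av hk hs ha hc.1 (by omega) with h1 | h1
    · exact absurd ⟨h1, hc⟩ hno
    · exact ⟨h1.1, c, h1.2, hc.1, by omega⟩
  · omega
  · omega
  · have h1 := h.corner_of_vertically_between av hk hs hl ha (z := c) (by omega) hc.2
    refine absurd ⟨h1, ?_, ?_⟩ hno
    · by_contra hX
      have : X c ≠ X a := fun hh => by have := h.injX hh; subst this; omega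
      exact h.corner_not_inc av hk h1 ha ⟨by omega, hc.2⟩
    · rcases hm with hm | rfl
      · by_contra hX
        have : X c ≠ X m := fun hh => by have := h.injX hh; subst this; omega
        exact h.corner_not_inc av hk hm h1 ⟨by omega, hc.1⟩
      · exact ((h.lower.corner k hk hs c).1 h1).2.1

/-- The counterpart of `separated_by_succ`, with `e (k + 1)` as a sentinel before the first entry of
`C (k + 1)`. It does not follow by `swap`, which keeps the order of the indices. -/
theorem separated_by_pred [Finite α] (h : Staircase X Y N σ e C S) (av : Avoids X Y)
    (sp : SimplePoints X Y) {k : ℕ} (hk : k ≤ N) (hs : σ k)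
    (hl : k + 1 ≤ N → ¬ Link X Y C (k + 1)) {b b' : α} (hb : C (k + 1) b)
    (hb' : C (k + 1) b' ∨ b' = e (k + 1)) (hlt : X b' < X b) :
    ∃ a, C k a ∧ X b' < X a ∧ X a < X b := by
  obtain ⟨m, ⟨hm, hm1⟩, hmax⟩ := Set.exists_max_image
    {z | (C (k + 1) z ∨ z = e (k + 1)) ∧ X z < X b} X (Set.toFinite _) ⟨b', hb', hlt⟩
  have hma := hmax b' ⟨hb', hlt⟩
  have hs1 : ¬ σ (k + 1) := by have := h.alt k (by omega); tauto
  have hcb := (h.mem_corner_succ hk hs).1 hb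
  have hrb := h.rect hk hs hcb.1 hcb.2.1
  have hme : X (e (k + 1)) ≤ X m ∧ Y m ≤ Y (e (k + 1)) ∧ Y b < Y m := by
    rcases hm with hm | rfl
    · have h1 := (h.mem_corner_succ hk hs).1 hm
      have h2 := h.rect hk hs h1.1 h1.2.1
      have hi := h.corner_not_inc av (by omega) hm hb
      have : Y m ≠ Y b := fun hh => by have := h.injY hh; subst this; omega
      refine ⟨by omega, by omega, ?_⟩
      by_contra hc
      exact hi ⟨hm1, by omega⟩
    · omega
  obtain ⟨c, hc⟩ := sp.sep m b (by rintro rfl; omega)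
  have hno : ¬ (C (k + 1) c ∧ X m < X c ∧ X c < X b) := fun hh => by
    have := hmax c ⟨Or.inl hh.1, hh.2.2⟩
    omega
  rcases hc with hc | hc | hc | hc
  · rcases h.rect_cases hk hs (z := c) (by omega) (by omega) with h1 | h1 | h1
    · exact ⟨c, h1, by omega, hc.2⟩
    · exact absurd ⟨h1, hc⟩ hno
    · have hm := h.central_mem h1.1 h1.2.1 hs h1.2.2
      exact absurd ⟨hc.2, hm.2.2.2 b hb⟩
        (h.central_not_inc av h1.1 h1.2.1 h1.2.2 (Or.inr (Or.inr hb))).1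
  · omega
  · omega
  · have h1 := h.corner_succ_of_vertically_between av hk hs hl hb (z := c) (by omega) hc.1
    refine absurd ⟨h1, ?_, ?_⟩ hno
    · rcases hm with hm | rfl
      · by_contra hX
        have : X c ≠ X m := fun hh => by have := h.injX hh; subst this; omega
        exact h.corner_not_inc av (by omega) h1 hm ⟨by omega, hc.2⟩
      · exact ((h.mem_corner_succ hk hs).1 h1).1
    · by_contra hX
      have : X c ≠ X b := fun hh => by have := h.injX hh; subst this; omega
      exact h.corner_not_inc av (by omega) hb h1 ⟨by omega, hc.1⟩

theorem alternate_of_link [Finite α] (h : Staircase X Y N σ e C S) (av : Avoids X Y)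
    (sp : SimplePoints X Y) {k : ℕ} (hk : k ≤ N) (hs : σ k) (hl : Link X Y C k) :
    Alternate X (C k) (C (k + 1)) := by
  have hl0 : ∀ j, j + 1 = k → ¬ Link X Y C j := by
    rintro j rfl hj
    exact h.not_link av hk hj hl
  have hl1 : k + 1 ≤ N → ¬ Link X Y C (k + 1) := fun hk' => h.not_link av hk' hl
  constructor
  · intro a a' ha ha' hlt
    exact (h.separated_by_succ av sp (by omega) hs hl0 ha (Or.inl ha') hlt).2
  · intro a ha
    obtain ⟨b, hb, h1, -⟩ := (h.separated_by_succ av sp (by omega) hs hl0 ha (Or.inr rfl)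
      ((h.mem_corner hk hs).1 ha).2.1).2
    exact ⟨b, hb, h1⟩
  · intro b b' hb hb' hlt
    exact h.separated_by_pred av sp hk hs hl1 hb' (Or.inl hb) hlt
  · intro b hb
    obtain ⟨a, ha, -, h1⟩ := h.separated_by_pred av sp hk hs hl1 hb (Or.inr rfl)
      ((h.mem_corner_succ hk hs).1 hb).1
    exact ⟨a, ha, h1⟩

/-- Without a link to the previous cell, `separated_by_succ` for `a` and the sentinel `e k` finds an
entry of the next cell to the right of `a`; it is above `a` by `corner_lt`. -/
theorem exists_link_of_lower [Finite α] (h : Staircase X Y N σ e C S) (av : Avoids X Y)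
    (sp : SimplePoints X Y) {k : ℕ} (hk : k ≤ N + 1) (hs : σ k) {a : α} (ha : C k a) :
    (1 ≤ k ∧ Link X Y C (k - 1)) ∨ (k ≤ N ∧ Link X Y C k) := by
  by_contra! hc
  have ha' := (h.lower.corner k hk hs a).1 ha
  obtain ⟨hkN, b, hb, h1, -⟩ := h.separated_by_succ av sp hk hs
    (by rintro j rfl; exact hc.1 (by omega)) ha (Or.inr rfl) ha'.2.1
  exact hc.2 hkN ⟨a, b, ha, hb, h1, h.corner_lt hkN hs ha hb⟩

theorem exists_link [Finite α] (h : Staircase X Y N σ e C S) (av : Avoids X Y)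
    (sp : SimplePoints X Y) {k : ℕ} (hk : k ≤ N + 1) {a : α} (ha : C k a) :
    (1 ≤ k ∧ Link X Y C (k - 1)) ∨ (k ≤ N ∧ Link X Y C k) := by
  by_cases hs : σ k
  · exact h.exists_link_of_lower av sp hk hs ha
  · simpa only [link_swap] using h.swap.exists_link_of_lower av.swap sp.swap hk hs ha

/-- Two successive entries of `S k` would have a separator. If horizontal and in an adjacent corner
cell, it forms an increasing pair with one of them; if vertical, the two paths confine it to `S k`,
where it would come between them. -/
theorem central_subsingleton_of_lower [Finite α] (h : Staircase X Y N σ e C S)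
    (av : Avoids X Y) (sp : SimplePoints X Y) {k : ℕ} (h1 : 1 ≤ k) (hk : k < N) (hs : σ k)
    {s s' : α} (hS : S k s) (hS' : S k s') : ¬ X s < X s' := by
  intro hlt
  obtain ⟨m, ⟨hm, hm1⟩, hmin⟩ := Set.exists_min_image {z | S k z ∧ X s < X z} X
    (Set.toFinite _) ⟨s', hS', hlt⟩
  have hi := h.central_not_inc av h1 hk hS (Or.inr (Or.inl hm))
  obtain ⟨c, hc⟩ := sp.sep s m (by rintro rfl; omega)
  have hno : ¬ (S k c ∧ X s < X c ∧ X c < X m) := fun hh => by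
    have := hmin c ⟨hh.1, hh.2.1⟩
    omega
  have hcs := h.central_mem h1 hk hs hS
  have hcm := h.central_mem h1 hk hs hm
  have hY : ¬ Y s < Y m := fun hY => hi.1 ⟨hm1, hY⟩
  rcases hc with hc | hc | hc | hc
  · rcases h.rect_cases hk.le hs (z := c) (by omega) (by omega) with hz | hz | hz
    · exact (h.central_not_inc av h1 hk hm (Or.inl hz)).2 ⟨hc.2, hcm.2.2.1 c hz⟩
    · exact (h.central_not_inc av h1 hk hS (Or.inr (Or.inr hz))).1 ⟨hc.1, hcs.2.2.2 c hz⟩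
    · exact hno ⟨hz.2.2, hc⟩
  · omega
  · omega
  · have hcS : S k c := by
      obtain ⟨k, rfl⟩ : ∃ j, k = j + 1 := ⟨k - 1, by omega⟩
      have hs0 : ¬ σ k := by have := h.alt k (by omega); tauto
      have hs2 : ¬ σ (k + 2) := by have := h.alt (k + 1) (by omega); tauto
      rw [h.lower.central k (by omega) hs] at *
      have i1 := h.upper.vacant k (by omega) hs0 c (by omega)
      have i2 := h.lower.vacant (k + 1) (by omega) hs c
      have i3 := h.upper.adj (k + 2) (by omega) hs2
      have i4 := h.upper.adj k (by omega) hs0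
      have i5 : X c ≠ X (e (k + 2)) := fun hh => by
        have := h.injX hh; subst this; simp only [Nat.add_assoc, Nat.reduceAdd] at *; omega
      have i6 : X c ≠ X (e (k + 1)) := fun hh => by have := h.injX hh; subst this; omega
      simp only [Nat.add_assoc, Nat.reduceAdd] at *
      omega
    refine hno ⟨hcS, ?_, ?_⟩
    · by_contra hX
      have : X c ≠ X s := fun hh => by have := h.injX hh; subst this; omega
      exact (h.central_not_inc av h1 hk hS (Or.inr (Or.inl hcS))).2 ⟨by omega, hc.2⟩
    · by_contra hX
      have : X c ≠ X m := fun hh => by have := h.injX hh; subst this; omega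
      exact (h.central_not_inc av h1 hk hm (Or.inr (Or.inl hcS))).1 ⟨by omega, hc.1⟩

theorem central_subsingleton [Finite α] (h : Staircase X Y N σ e C S)
    (av : Avoids X Y) (sp : SimplePoints X Y) {k : ℕ} (h1 : 1 ≤ k) (hk : k < N)
    {s s' : α} (hS : S k s) (hS' : S k s') : s = s' := by
  by_cases hs : σ k
  · exact h.injX (le_antisymm
      (not_lt.1 (h.central_subsingleton_of_lower av sp h1 hk hs hS' hS))
      (not_lt.1 (h.central_subsingleton_of_lower av sp h1 hk hs hS hS')))
  · exact h.injY (le_antisymm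
      (not_lt.1 (h.swap.central_subsingleton_of_lower av.swap sp.swap h1 hk hs hS' hS))
      (not_lt.1 (h.swap.central_subsingleton_of_lower av.swap sp.swap h1 hk hs hS hS')))

end Staircase

/-! ### The cell conditions exclude the three patterns. -/

/-- Conditions on the cells of a staircase, where `I k` says that the corner cells with indices `k`
and `k + 1` interlace. -/
structure CellConditions (X Y : α → ℤ) (N : ℕ) (C S : ℕ → α → Prop) (I : ℕ → Prop) : Prop where
  corner : ∀ k, k ≤ N + 1 → ∀ a b, C k a → C k b → ¬ Inc X Y a b
  consecutive : ∀ k, k ≤ N → I k ∨ ∀ a b, C k a → C (k + 1) b → ¬ Inc X Y a b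
  once : ∀ k, k + 1 ≤ N → I k → ¬ I (k + 1)
  central : ∀ k, 1 ≤ k → k < N → (I k ∧ ∀ z, ¬ S k z) ∨
    ∀ a b, (C k a ∨ S k a ∨ C (k + 1) a) → (C k b ∨ S k b ∨ C (k + 1) b) → ¬ Inc X Y a b

theorem CellConditions.swap {X Y : α → ℤ} {N : ℕ} {C S : ℕ → α → Prop} {I : ℕ → Prop}
    (h : CellConditions X Y N C S I) : CellConditions Y X N C S I where
  corner k hk a b ha hb hi := h.corner k hk a b ha hb hi.symm
  consecutive k hk := (h.consecutive k hk).imp_right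
    fun hc a b ha hb hi => hc a b ha hb hi.symm
  once := h.once
  central k h1 hk := (h.central k h1 hk).imp_right
    fun hc a b ha hb hi => hc a b ha hb hi.symm

namespace Staircase

variable {X Y : α → ℤ} {N : ℕ} {σ : ℕ → Prop} {e : ℕ → α} {C S : ℕ → α → Prop} {I : ℕ → Prop}

/-- The strip holds only `C k`, `S k` and `C (k + 1)`. The conditions, with `corner_lt`, leave room
for an increasing pair only from `C k` to `C (k + 1)`, and only if these interlace. -/
theorem corner_of_inc (h : Staircase X Y N σ e C S) (cc : CellConditions X Y N C S I) {k : ℕ}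
    (hk : k ≤ N) (hs : σ k) {u v : α} (hu : X (e (k + 1)) < X u) (hv : X v < X (e k))
    (hi : Inc X Y u v) : C k u ∧ C (k + 1) v ∧ I k := by
  have hcu := h.rect_cases hk hs hu (hi.1.trans hv)
  have hcv := h.rect_cases hk hs (hu.trans hi.1) hv
  by_cases hS : 1 ≤ k ∧ k < N ∧ (S k u ∨ S k v)
  · rcases cc.central k hS.1 hS.2.1 with h3 | h3
    · exact absurd hS.2.2 (not_or.2 ⟨h3.2 u, h3.2 v⟩)
    · exact absurd hi (h3 u v (by tauto) (by tauto))
  · have hcu : C k u ∨ C (k + 1) u := by tauto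
    have hcv : C k v ∨ C (k + 1) v := by tauto
    rcases hcu with hcu | hcu <;> rcases hcv with hcv | hcv
    · exact absurd hi (cc.corner k (by omega) u v hcu hcv)
    · refine ⟨hcu, hcv, (cc.consecutive k hk).resolve_right fun hc => hc u v hcu hcv hi⟩
    · exact absurd hi.2 (h.corner_lt hk hs hcv hcu).not_gt
    · exact absurd hi (cc.corner (k + 1) (by omega) u v hcu hcv)

/-- The l-r maxes `e (k - 1)` and `e (k + 1)` are consecutive, so an entry left of `e (k + 1)` is
not above `e (k - 1)`. -/
theorem upperLeft_cases (h : Staircase X Y N σ e C S) {k : ℕ} (hk : k ≤ N + 1) (hs : σ k) {z : α}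
    (h1 : X z < X (e k)) :
    (k ≤ N ∧ X (e (k + 1)) ≤ X z) ∨
      ∃ j, k = j + 1 ∧ Y z ≤ Y (e j) ∧ (k ≤ N → X z < X (e (k + 1))) := by
  have hN := h.two_le
  by_cases hc : k ≤ N ∧ X (e (k + 1)) ≤ X z
  · exact Or.inl hc
  right
  cases k with
  | zero =>
    have hs1 : ¬ σ 1 := by have := h.alt 0 (by omega); tauto
    exact absurd ⟨by omega, h.upper.lowest 1 (by omega) hs1 z⟩ hc
  | succ k =>
    have hs0 : ¬ σ k := by have := h.alt k (by omega); tauto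
    refine ⟨k, rfl, ?_, fun hk => by omega⟩
    by_contra hlt
    rcases Nat.lt_or_ge k N with hk' | hk'
    · exact hc ⟨hk', h.upper.vacant k (by omega) hs0 z (by omega)⟩
    · exact hlt (h.upper.rightmost k hk' (by omega) hs0 z)

/-- The first r-l min `e k` that is not left of `z` will do: the one before it is left of `z`, so
`vacant` bounds `z` from below. -/
theorem exists_lowerRight (h : Staircase X Y N σ e C S) (z : α) :
    ∃ k, k ≤ N + 1 ∧ σ k ∧ X z ≤ X (e k) ∧ Y (e k) ≤ Y z := by
  classical
  have hex : ∃ k, k ≤ N + 1 ∧ σ k ∧ X z ≤ X (e k) := by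
    by_cases hs : σ N
    · exact ⟨N, by omega, hs, h.lower.rightmost N le_rfl (by omega) hs z⟩
    · have := (h.alt N le_rfl).2 hs
      exact ⟨N + 1, le_rfl, this, h.lower.rightmost _ (by omega) le_rfl this z⟩
  obtain ⟨h1, h2, h3⟩ := Nat.find_spec hex
  have hmin := fun m => Nat.find_min hex (m := m)
  revert h1 h2 h3 hmin
  generalize Nat.find hex = k
  intro h1 h2 h3 hmin
  refine ⟨k, h1, h2, h3, ?_⟩
  match k, h1, h2, h3, hmin with
  | 0, _, h2, _, _ => exact h.lower.lowest 0 (by omega) h2 z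
  | 1, _, h2, _, _ => exact h.lower.lowest 1 (by omega) h2 z
  | j + 2, h1, h2, h3, hmin =>
    have hs : σ j := by
      have := h.alt (j + 1) (by omega); have := h.alt j (by omega); tauto
    have hj := hmin j (by omega)
    exact h.lower.vacant j (by omega) hs z (by by_contra; exact hj ⟨by omega, hs, by omega⟩)

/-- Let `e k` take over the role of the 1. If `v` is right of `e (k + 1)`, then `v`, `w` force an
interlacing of `C k` with `C (k + 1)`, and `u`, `v` one of `C (k - 1)` with `C k`, against `once`.
Otherwise `u`, `v` are in the strip of `e (k - 1)` and `e k`, which puts `v` in `C k` and so right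
of `e (k + 1)` after all. -/
theorem no2341 (h : Staircase X Y N σ e C S) (cc : CellConditions X Y N C S I) (u v w z : α)
    (h1 : X u < X v) (h2 : X v < X w) (h3 : X w < X z) (h4 : Y z < Y u) (h5 : Y u < Y v)
    (h6 : Y v < Y w) : False := by
  have hN := h.two_le
  obtain ⟨k, hk, hs, hzX, hzY⟩ := h.exists_lowerRight z
  rcases h.upperLeft_cases hk hs (z := v) (by omega) with ⟨hkN, hv⟩ | ⟨j, rfl, hv, hvX⟩
  · have hw := h.rect hkN hs (z := w) (by omega) (by omega)
    have hv' : X v ≠ X (e (k + 1)) := fun hh => by have := h.injX hh; subst this; omega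
    obtain ⟨hCv, -, hI⟩ := h.corner_of_inc cc hkN hs (u := v) (v := w) (by omega) (by omega)
      ⟨h2, h6⟩
    have hCv' := (h.mem_corner hkN hs).1 hCv
    cases k with
    -- No cell precedes `C 0`; here `u` is in the same strip as `v`, so `v` would be in both `C 0`
    -- and `C 1`.
    | zero =>
      have hs1 : ¬ σ 1 := by have := h.alt 0 (by omega); tauto
      have i1 := h.upper.lowest 1 (by omega) hs1 u
      have hu : X u ≠ X (e (0 + 1)) := fun hh => by have := h.injX hh; subst this; omega
      obtain ⟨-, hCv1, -⟩ := h.corner_of_inc cc hkN hs (u := u) (v := v)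
        (by simp only [zero_add] at *; omega) (by omega) ⟨h1, h5⟩
      exact lt_irrefl _ (h.corner_lt hkN hs hCv hCv1)
    | succ j =>
      rw [prv_succ] at hCv'
      have hs0 : ¬ σ j := by have := h.alt j (by omega); tauto
      exact cc.once j hkN (h.swap.corner_of_inc cc.swap (k := j) (by omega) hs0 (u := u) (v := v)
        (by omega) (by omega) ⟨h5, h1⟩).2.2 hI
  · have hs0 : ¬ σ j := by have := h.alt j (by omega); tauto
    have hu := h.swap.rect (k := j) (by omega) hs0 (z := u) (by omega) (by omega)
    have hvY : Y v ≠ Y (e j) := fun hh => by have := h.injY hh; subst this; omega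
    obtain ⟨-, hCv, -⟩ := h.swap.corner_of_inc cc.swap (k := j) (by omega) hs0 (u := u) (v := v)
      (by omega) (by omega) ⟨h5, h1⟩
    rcases Nat.lt_or_ge j N with hj | hj
    · have := (h.mem_corner (k := j + 1) hj hs).1 hCv
      have := hvX hj
      omega
    -- Nothing is above the l-r max `e N`, so `w` is in the same strip, and `v` would be in both `C
    -- N` and `C (N + 1)`.
    · obtain rfl : j = N := by omega
      have i1 := (h.lower.corner _ hk hs v).1 hCv
      rw [nxt_last] at i1
      obtain ⟨j, rfl⟩ : ∃ i, j = i + 1 := ⟨j - 1, by omega⟩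
      rw [Nat.add_sub_cancel] at i1
      have hs1 : σ j := by have := h.alt j (by omega); tauto
      have i2 := h.lower.adj j (by omega) hs1
      have i3 := h.upper.rightmost (j + 1) le_rfl (by omega) hs0 w
      have i4 : Y w ≠ Y (e (j + 1)) := fun hh => by have := h.injY hh; subst this; omega
      obtain ⟨hCv', -, -⟩ := h.swap.corner_of_inc cc.swap (k := j + 1) le_rfl hs0
        (u := v) (v := w) (by omega) (by omega) ⟨h6, h2⟩
      exact lt_irrefl _ (h.swap.corner_lt (k := j + 1) le_rfl hs0 hCv' hCv)

theorem no3412 (h : Staircase X Y N σ e C S) (cc : CellConditions X Y N C S I) (a b c d : α)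
    (h1 : X a < X b) (h2 : X b < X c) (h3 : X c < X d) (h4 : Y c < Y d) (h5 : Y d < Y a)
    (h6 : Y a < Y b) : False := by
  have hN := h.two_le
  obtain ⟨k, hk, hs, hdX, hdY⟩ := h.exists_lowerRight d
  have key : ∀ j, k = j + 1 → Y b ≤ Y (e j) → C j a ∧ C k b := by
    rintro j rfl hb
    have hs0 : ¬ σ j := by have := h.alt j (by omega); tauto
    have ha := h.swap.rect (k := j) (by omega) hs0 (z := a) (by omega) (by omega)
    have hb' : Y b ≠ Y (e j) := fun hh => by have := h.injY hh; subst this; omega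
    obtain ⟨hCa, hCb, -⟩ := h.swap.corner_of_inc cc.swap (k := j) (by omega) hs0 (u := a) (v := b)
      (by omega) (by omega) ⟨h6, h1⟩
    exact ⟨hCa, hCb⟩
  -- If `c` were below `e k`, it would not be right of the previous r-l min `e (k - 2)`. Then `b`
  -- would be left of the whole cell `C k`, where `key` puts it.
  have hc : Y (e k) < Y c := by
    by_contra hc
    have hc' : Y c ≠ Y (e k) := fun hh => by have := h.injY hh; subst this; omega
    match k, hk, hs, hdX, hdY, hc, hc', key with
    | 0, _, hs, _, _, _, _, _ => have := h.lower.lowest 0 (by omega) hs c; omega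
    | 1, _, hs, _, _, _, _, _ => have := h.lower.lowest 1 (by omega) hs c; omega
    | j + 2, hk, hs, hdX, hdY, hc, hc', key =>
      have hs0 : σ j := by
        have := h.alt (j + 1) (by omega); have := h.alt j (by omega); tauto
      have i1 := h.lower.vacant j (by omega) hs0 c
      have i2 := h.lower.lt_three j
      rcases h.upperLeft_cases hk hs (z := b) (by omega) with ⟨hkN, hb⟩ | ⟨i, hi, hb, -⟩
      · have := i2 hkN hs0
        simp only [Nat.add_assoc, Nat.reduceAdd] at *
        omega
      · obtain rfl : i = j + 1 := by omega
        have hCb := (h.lower.corner _ hk hs b).1 (key (j + 1) rfl hb).2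
        rcases Nat.lt_or_ge N (j + 2) with hk' | hk'
        · obtain rfl : N = j + 1 := by omega
          rw [nxt_last, Nat.add_sub_cancel] at hCb
          omega
        · rw [nxt_of_le hk'] at hCb
          have := i2 hk' hs0
          simp only [Nat.add_assoc, Nat.reduceAdd] at *
          omega
  have hd : X d ≠ X (e k) := fun hh => by have := h.injX hh; subst this; omega
  -- If `c` is right of `e (k + 1)`, then `d` is in `C (k + 1)`, too high to be below `a`. Otherwise
  -- `c` is in `C (k - 1)` and `b` in `C k`, so that `c` is left of `b`.
  rcases h.upperLeft_cases hk hs (z := c) (by omega) with ⟨hkN, hcX⟩ | ⟨j, rfl, hcY, hcX⟩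
  · have hrd := h.rect hkN hs (z := d) (by omega) (by omega)
    have hc' : X c ≠ X (e (k + 1)) := fun hh => by have := h.injX hh; subst this; omega
    obtain ⟨-, hCd, -⟩ := h.corner_of_inc cc hkN hs (u := c) (v := d) (by omega) (by omega)
      ⟨h3, h4⟩
    rcases h.upperLeft_cases hk hs (z := a) (by omega) with ⟨-, haX⟩ | ⟨j, rfl, haY, -⟩
    · have hrb := h.rect hkN hs (z := b) (by omega) (by omega)
      have ha' : X a ≠ X (e (k + 1)) := fun hh => by have := h.injX hh; subst this; omega
      obtain ⟨hCa, -, -⟩ := h.corner_of_inc cc hkN hs (u := a) (v := b) (by omega) (by omega)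
        ⟨h1, h6⟩
      have := h.corner_lt hkN hs hCa hCd
      omega
    · have i1 := (h.mem_corner_succ hkN hs).1 hCd
      have i2 := h.prv_le_nxt hkN hs
      rw [prv_succ] at i2
      omega
  · have hs0 : ¬ σ j := by have := h.alt j (by omega); tauto
    rcases h.upperLeft_cases hk hs (z := b) (by omega) with ⟨hkN, hbX⟩ | ⟨i, hi, hbY, -⟩
    · have := hcX hkN
      omega
    · obtain rfl : i = j := by omega
      obtain ⟨-, hCb⟩ := key i rfl hbY
      obtain ⟨hCc, -, -⟩ := h.swap.corner_of_inc cc.swap (k := i) (by omega) hs0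
        (u := c) (v := d) (by omega) (by omega) ⟨h4, h3⟩
      have := h.swap.corner_lt (k := i) (by omega) hs0 hCc hCb
      omega

theorem avoids (h : Staircase X Y N σ e C S) (cc : CellConditions X Y N C S I) :
    Avoids X Y where
  no2341 := h.no2341 cc
  no4123 z u v w h1 h2 h3 h4 h5 h6 := h.swap.no2341 cc.swap u v w z h4 h5 h6 h1 h2 h3
  no3412 := h.no3412 cc

end Staircase

/-! ### Right-to-left minima and inflections of point sets. -/

/-- The point `a` is a right-to-left minimum with respect to the coordinates `X`, `Y`; with the
coordinates interchanged, it is a left-to-right maximum. -/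
def RLMin (X Y : α → ℤ) (a : α) : Prop := ∀ b, X a < X b → Y a < Y b

/-- `(x, y)` is an inflection of the right-to-left minimum path; with the coordinates interchanged,
it is an inflection of the left-to-right maximum path. -/
def MinInflection (X Y : α → ℤ) (x y : ℤ) : Prop :=
  ∃ i j, RLMin X Y i ∧ RLMin X Y j ∧ X i < X j ∧ (∀ k, X i < X k → X k < X j → ¬ RLMin X Y k) ∧
    x = X i ∧ y = Y j

theorem exists_rlMin [Finite α] (X Y : α → ℤ) (z : α) :
    ∃ r, RLMin X Y r ∧ X z ≤ X r ∧ Y r ≤ Y z := by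
  obtain ⟨y, ⟨hy, hy'⟩, hmin⟩ := Set.exists_min_image {r | X z ≤ X r ∧ Y r ≤ Y z} Y
    (Set.toFinite _) ⟨z, le_rfl, le_rfl⟩
  -- `Y` is not assumed injective, so the rightmost of the lowest points is taken.
  obtain ⟨r, ⟨h1, h2⟩, hmax⟩ := Set.exists_max_image {r | X z ≤ X r ∧ Y r = Y y} X
    (Set.toFinite _) ⟨y, hy, rfl⟩
  refine ⟨r, fun b hb => ?_, h1, by omega⟩
  by_contra hlt
  have := hmin b ⟨by omega, by omega⟩
  have := hmax b ⟨by omega, by omega⟩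
  omega

theorem exists_pred_rlMin [Finite α] {X Y : α → ℤ} (hX : Function.Injective X) {a z : α}
    (ha : RLMin X Y a) (hz : Y z < Y a) :
    ∃ i, RLMin X Y i ∧ X i < X a ∧ ∀ k, X i < X k → X k < X a → ¬ RLMin X Y k := by
  obtain ⟨r, hr, -, h2⟩ := exists_rlMin X Y z
  have hne : X r ≠ X a := fun hh => by have := hX hh; subst this; omega
  have hra : X r < X a := by
    by_contra hc
    have := ha r (by omega)
    omega
  obtain ⟨i, ⟨hi, hia⟩, hmax⟩ := Set.exists_max_image {i | RLMin X Y i ∧ X i < X a} X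
    (Set.toFinite _) ⟨r, hr, hra⟩
  exact ⟨i, hi, hia, fun k h1 h2 h3 => by have := hmax k ⟨h3, h2⟩; omega⟩

/-- There is no point below and to the right of an inflection of the right-to-left minimum path. -/
theorem le_of_consecutive [Finite α] {X Y : α → ℤ} {i j z : α} (hj : RLMin X Y j)
    (hij : ∀ k, X i < X k → X k < X j → ¬ RLMin X Y k) (hinj : Function.Injective X)
    (hz : X i < X z) : Y j ≤ Y z := by
  obtain ⟨r, hr, h1, h2⟩ := exists_rlMin X Y z
  rcases lt_trichotomy (X r) (X j) with h | h | h
  · exact absurd hr (hij r (by omega) h)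
  · rw [← hinj h]; exact h2
  · have := hj r h
    omega

/-- Everything left of such a point would be below it and everything right of it above. As there is
no direct sum decomposition, both sides are empty, which makes the point extreme to the lower right.
-/
theorem SimplePoints.not_rlMin_swap {X Y : α → ℤ} (sp : SimplePoints X Y) {a : α}
    (h1 : RLMin X Y a) : ¬ RLMin Y X a := by
  intro h2
  have hle : ∀ b, X b ≤ X a → Y b ≤ Y a := fun b hb => by
    by_contra hc
    have := h2 b (by omega)
    omega
  have hge : ∀ b, X a ≤ X b → Y a ≤ Y b := fun b hb => by
    rcases hb.eq_or_lt with hb | hb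
    · rw [sp.injX hb]
    · exact (h1 b hb).le
  have hl : ∀ b, X a ≤ X b := by
    have hinc : ∀ b c, X b < X a → ¬ X c < X a → Inc X Y b c := by
      intro b c hb hc
      have : Y b ≠ Y a := fun hh => by have := sp.injY hh; subst this; omega
      have := hle b hb.le
      have := hge c (not_lt.1 hc)
      exact ⟨by omega, by omega⟩
    rcases sp.cut (fun b => X b < X a) hinc with h | h
    · exact absurd (h a) (lt_irrefl _)
    · exact fun b => not_lt.1 (h b)
  have hr : ∀ b, X b ≤ X a := by
    have hinc : ∀ b c, X b ≤ X a → ¬ X c ≤ X a → Inc X Y b c := by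
      intro b c hb hc
      have := hle b hb
      have := h1 c (not_le.1 hc)
      exact ⟨by omega, by omega⟩
    rcases sp.cut (fun b => X b ≤ X a) hinc with h | h
    · exact h
    · exact absurd le_rfl (h a)
  exact sp.lowerRight a hr fun b => hge b (hl b)

/-! ### From the list of inflections to a staircase. -/

/-- `(px 1, py 1), …, (px N, py N)` is an increasing list of all the inflections, those of the
left-to-right maximum path being the ones with `σ k`. -/
structure InflectionSequence (X Y : α → ℤ) (N : ℕ) (σ : ℕ → Prop) (px py : ℕ → ℤ) : Prop where
  alt : ∀ k, k ≤ N → (σ (k + 1) ↔ ¬ σ k)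
  incX : ∀ k, k ≤ N → px k < px (k + 1)
  incY : ∀ k, k ≤ N → py k < py (k + 1)
  boundX : ∀ z, px 0 < X z ∧ X z < px (N + 1)
  boundY : ∀ z, py 0 < Y z ∧ Y z < py (N + 1)
  sound_min : ∀ k, 1 ≤ k → k ≤ N → ¬ σ k → MinInflection X Y (px k) (py k)
  sound_max : ∀ k, 1 ≤ k → k ≤ N → σ k → MinInflection Y X (py k) (px k)
  complete_min : ∀ x y, MinInflection X Y x y → ∃ k, 1 ≤ k ∧ k ≤ N ∧ ¬ σ k ∧ px k = x ∧ py k = y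
  complete_max : ∀ y x, MinInflection Y X y x → ∃ k, 1 ≤ k ∧ k ≤ N ∧ σ k ∧ px k = x ∧ py k = y

/-- The properties of the corner point with index `k`, if it is a right-to-left minimum. -/
structure CornerPoint (X Y : α → ℤ) (N : ℕ) (px py : ℕ → ℤ) (k : ℕ) (a : α) : Prop where
  rlMin : RLMin X Y a
  next : k + 1 ≤ N → X a = px (k + 1)
  rightmost : N ≤ k → ∀ z, X z ≤ X a
  prev : ∀ j, k = j + 2 → Y a = py (j + 1)
  lowest : k ≤ 1 → ∀ z, Y a ≤ Y z

namespace InflectionSequence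

variable {X Y : α → ℤ} {N : ℕ} {σ : ℕ → Prop} {px py : ℕ → ℤ}

theorem swap (h : InflectionSequence X Y N σ px py) :
    InflectionSequence Y X N (fun k => ¬ σ k) py px where
  alt k hk := by rw [h.alt k hk]
  incX := h.incY
  incY := h.incX
  boundX := h.boundY
  boundY := h.boundX
  sound_min k h1 hk hs := h.sound_max k h1 hk (not_not.1 hs)
  sound_max k h1 hk hs := h.sound_min k h1 hk hs
  complete_min y x hi := by
    obtain ⟨k, h1, h2, h3, h4, h5⟩ := h.complete_max y x hi
    exact ⟨k, h1, h2, not_not.2 h3, h5, h4⟩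
  complete_max x y hi := by
    obtain ⟨k, h1, h2, h3, h4, h5⟩ := h.complete_min x y hi
    exact ⟨k, h1, h2, h3, h5, h4⟩

theorem monoX (h : InflectionSequence X Y N σ px py) {i j : ℕ} (hij : i ≤ j) (hj : j ≤ N + 1) :
    px i ≤ px j := by
  induction j, hij using Nat.le_induction with
  | base => exact le_rfl
  | succ j hij ih => exact (ih (by omega)).trans (h.incX j (by omega)).le

theorem monoY (h : InflectionSequence X Y N σ px py) {i j : ℕ} (hij : i ≤ j) (hj : j ≤ N + 1) :
    py i ≤ py j := h.swap.monoX hij hj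

/-- The rightmost point is an r-l min and, by simplicity, not the lowest point. So another r-l min
precedes it, and the path turns between them. -/
theorem exists_min [Finite α] [Nonempty α] (h : InflectionSequence X Y N σ px py)
    (sp : SimplePoints X Y) : ∃ k, 1 ≤ k ∧ k ≤ N ∧ ¬ σ k := by
  obtain ⟨a, -, ha⟩ := Set.exists_max_image (Set.univ : Set α) X Set.finite_univ Set.univ_nonempty
  have haX : ∀ z, X z ≤ X a := fun z => ha z trivial
  have hr : RLMin X Y a := fun b hb => by have := haX b; omega
  obtain ⟨z, hz⟩ : ∃ z, Y z < Y a := by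
    by_contra! hc
    exact sp.lowerRight a haX hc
  obtain ⟨i, hi, hia, hb⟩ := exists_pred_rlMin sp.injX hr hz
  obtain ⟨k, h1, h2, h3, -⟩ := h.complete_min _ _ ⟨i, a, hi, hr, hia, hb, rfl, rfl⟩
  exact ⟨k, h1, h2, h3⟩

theorem two_le [Finite α] [Nonempty α] (h : InflectionSequence X Y N σ px py)
    (sp : SimplePoints X Y) : 2 ≤ N := by
  obtain ⟨k, h1, h2, h3⟩ := h.exists_min sp
  obtain ⟨l, h4, h5, h6⟩ := h.swap.exists_min sp.swap
  have : k ≠ l := by rintro rfl; exact h6 h3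
  omega

theorem exists_cornerPoint [Finite α] [Nonempty α] (h : InflectionSequence X Y N σ px py)
    (sp : SimplePoints X Y) {k : ℕ} (hk : k ≤ N + 1) (hs : σ k) :
    ∃ a, CornerPoint X Y N px py k a := by
  obtain ⟨a, ha, h1, h2, h3⟩ : ∃ a, RLMin X Y a ∧ (k + 1 ≤ N → X a = px (k + 1)) ∧
      (k + 1 ≤ N → Y a < py (k + 1)) ∧ (N ≤ k → ∀ z, X z ≤ X a) := by
    by_cases hkN : k + 1 ≤ N
    · have hs1 : ¬ σ (k + 1) := by have := h.alt k (by omega); tauto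
      obtain ⟨i, j, hi, hj, hij, -, hx, hy⟩ := h.sound_min (k + 1) (by omega) hkN hs1
      exact ⟨i, hi, fun _ => hx.symm, fun _ => by rw [hy]; exact hi j hij,
        fun _ => by omega⟩
    · obtain ⟨a, -, ha⟩ := Set.exists_max_image (Set.univ : Set α) X Set.finite_univ
        Set.univ_nonempty
      have haX : ∀ z, X z ≤ X a := fun z => ha z trivial
      exact ⟨a, fun b hb => by have := haX b; omega, fun _ => by omega, fun _ => by omega,
        fun _ => haX⟩
  have hpred : ∀ z, Y z < Y a → ∃ i l, X i < X a ∧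
      (∀ k, X i < X k → X k < X a → ¬ RLMin X Y k) ∧ RLMin X Y i ∧ py l = Y a ∧ 1 ≤ l ∧ l < k := by
    intro z hz
    obtain ⟨i, hi, hia, hb⟩ := exists_pred_rlMin sp.injX ha hz
    obtain ⟨l, hl1, hlN, hsl, -, hly⟩ := h.complete_min _ _ ⟨i, a, hi, ha, hia, hb, rfl, rfl⟩
    refine ⟨i, l, hia, hb, hi, hly, hl1, ?_⟩
    have hlk : l ≠ k := by rintro rfl; exact hsl hs
    by_contra hc
    by_cases hkN : k + 1 ≤ N
    · have := h.monoY (show k + 1 ≤ l by omega) (by omega)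
      have := h2 hkN
      omega
    · omega
  refine ⟨a, ha, h1, h3, ?_, ?_⟩
  -- Let `j'` be the upper end of the inflection with index `k - 1`. If `j'` were left of `a`, the
  -- inflection arriving at `a` would have a smaller or equal index and a greater height. If it were
  -- right of `a`, then `a` would lie between consecutive r-l mins or fail to be rightmost.
  · rintro j rfl
    have hs1 : ¬ σ (j + 1) := by have := h.alt (j + 1) (by omega); tauto
    obtain ⟨i', j', hi', hj', hij, hb', hx, hy⟩ :=
      h.sound_min (j + 1) (by omega) (by omega) hs1
    rw [hy]
    rcases lt_trichotomy (X j') (X a) with hlt | heq | hgt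
    · have hY := hj' a hlt
      obtain ⟨i, l, hia, hb, hi, hly, -, hl⟩ := hpred j' hY
      have := h.monoY (show l ≤ j + 1 by omega) (by omega)
      omega
    · rw [sp.injX heq]
    · exfalso
      by_cases hkN : j + 2 + 1 ≤ N
      · have := h1 hkN
        have := h.incX (j + 1) (by omega)
        have := h.incX (j + 2) (by omega)
        simp only [Nat.add_assoc, Nat.reduceAdd] at *
        exact hb' a (by omega) hgt ha
      · have := h3 (by omega) j'
        omega
  · intro hk1 z
    by_contra hz
    obtain ⟨i, l, -, -, -, -, hl1, hl⟩ := hpred z (by omega)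
    omega

/-- Column `min k N` and row `k - 1`, with truncated subtraction, describe the inner and both end
cells at once: `k = 0` gives column and row `0`, and `k = N + 1` gives column and row `N`. -/
theorem halfStaircase [Finite α] [Nonempty α] (h : InflectionSequence X Y N σ px py)
    (sp : SimplePoints X Y) {e : ℕ → α}
    (he : ∀ k, k ≤ N + 1 → σ k → CornerPoint X Y N px py k (e k))
    (he' : ∀ k, k ≤ N + 1 → ¬ σ k → CornerPoint Y X N py px k (e k))
    {C S : ℕ → α → Prop}
    (hC : ∀ k, k ≤ N + 1 → σ k → ∀ z, C k z ↔ px (min k N) < X z ∧ X z < px (min k N + 1) ∧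
      py (k - 1) < Y z ∧ Y z < py (k - 1 + 1))
    (hS : ∀ k, 1 ≤ k → k < N → ∀ z, S k z ↔ px k < X z ∧ X z < px (k + 1) ∧
      py k < Y z ∧ Y z < py (k + 1)) : HalfStaircase X Y N σ e C S := by
  have hN := h.two_le sp
  have hne : ∀ k l, k ≤ N + 1 → l ≤ N + 1 → σ k → ¬ σ l → e k ≠ e l := fun k l hk hl h1 h2 h3 =>
    sp.not_rlMin_swap (he k hk h1).rlMin (h3 ▸ (he' l hl h2).rlMin)
  have hadj : ∀ k, k ≤ N → σ k → X (e (k + 1)) < X (e k) ∧ Y (e k) < Y (e (k + 1)) := by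
    intro k hk hs
    have hs1 : ¬ σ (k + 1) := by have := h.alt k (by omega); tauto
    have a := he k (by omega) hs
    have b := he' (k + 1) (by omega) hs1
    have hX : X (e k) ≠ X (e (k + 1)) := sp.injX.ne (hne _ _ (by omega) (by omega) hs hs1)
    have hY : Y (e k) ≠ Y (e (k + 1)) := sp.injY.ne (hne _ _ (by omega) (by omega) hs hs1)
    constructor
    · cases k with
      | zero => have := b.lowest (by omega) (e 0); omega
      | succ j =>
        have h1 := b.prev j rfl
        by_cases hkN : j + 1 + 1 ≤ N
        · have := a.next hkN
          have := h.incX (j + 1) (by omega)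
          omega
        · have := a.rightmost (by omega) (e (j + 1 + 1))
          omega
    · by_cases hkN : k + 1 + 1 ≤ N
      · have h1 := b.next hkN
        by_cases hk1 : k ≤ 1
        · have := a.lowest hk1 (e (k + 1))
          omega
        · obtain ⟨j, rfl⟩ : ∃ j, k = j + 2 := ⟨k - 2, by omega⟩
          have := a.prev j rfl
          have := h.incY (j + 1) (by omega)
          have := h.monoY (show j + 2 ≤ j + 2 + 1 + 1 by omega) (by omega)
          simp only [Nat.add_assoc, Nat.reduceAdd] at *
          omega
      · have := b.rightmost (by omega) (e k)
        omega
  have hcons : ∀ k, k + 1 ≤ N → σ k → RLMin X Y (e (k + 2)) ∧ X (e k) < X (e (k + 2)) ∧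
      ∀ l, X (e k) < X l → X l < X (e (k + 2)) → ¬ RLMin X Y l := by
    intro k hk hs
    have hs1 : ¬ σ (k + 1) := by have := h.alt k (by omega); tauto
    have hs2 : σ (k + 2) := by have := h.alt (k + 1) (by omega); tauto
    obtain ⟨i, j, hi, hj, hij, hb, hx, hy⟩ := h.sound_min (k + 1) (by omega) hk hs1
    have a := he k (by omega) hs
    have b := he (k + 2) (by omega) hs2
    obtain rfl : e k = i := sp.injX (by rw [← hx, a.next hk])
    obtain rfl : e (k + 2) = j := sp.injY (by rw [← hy, b.prev k rfl])
    exact ⟨hj, hij, hb⟩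
  refine ⟨hadj, ?_, ?_, ?_, ?_, ?_, ?_, ?_⟩
  · intro k hk hs
    have h1 := hcons k hk hs
    exact ⟨h1.2.1, (he k (by omega) hs).rlMin _ h1.2.1⟩
  · intro k hk hs
    have hs1 : ¬ σ (k + 3) := by
      have := h.alt k (by omega); have := h.alt (k + 1) (by omega)
      have := h.alt (k + 2) (by omega); tauto
    have h1 := (he k (by omega) hs).next (by omega)
    have h2 := (he' (k + 3) (by omega) hs1).prev (k + 1) rfl
    have := h.incX (k + 1) (by omega)
    omega
  · intro k hk hs z hz
    have h1 := hcons k hk hs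
    exact le_of_consecutive h1.1 h1.2.2 sp.injX hz
  · intro k hk hs
    exact (he k (by omega) hs).lowest hk
  · intro k hk hk' hs
    exact (he k hk' hs).rightmost hk
  · intro k hk hs z
    rw [hC k hk hs]
    have bX := h.boundX z
    have bY := h.boundY z
    have a := he k hk hs
    have nX : X (e k) ≠ X z ∨ e k = z := by
      by_cases hh : X (e k) = X z
      · exact Or.inr (sp.injX hh)
      · exact Or.inl hh
    have nY : Y (e k) ≠ Y z ∨ X (e k) = X z := by
      by_cases hh : Y (e k) = Y z
      · exact Or.inr (by rw [sp.injY hh])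
      · exact Or.inl hh
    have nX : X (e k) ≠ X z ∨ Y (e k) = Y z := nX.imp_right fun hh => by rw [hh]
    rcases Nat.lt_or_ge N k with hk' | hk'
    · obtain rfl : k = N + 1 := by omega
      obtain ⟨i, rfl⟩ : ∃ i, N = i + 2 := ⟨N - 2, by omega⟩
      have hs1 : ¬ σ (i + 2) := by have := h.alt (i + 2) (by omega); tauto
      have hs0 : σ (i + 1) := by have := h.alt (i + 1) (by omega); tauto
      rw [nxt_last, prv_succ]
      have b := he' (i + 2) (by omega) hs1
      have c := he (i + 1) (by omega) hs0
      have i1 := a.prev (i + 1) rfl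
      have i2 := b.prev i rfl
      have i3 := b.rightmost le_rfl z
      have i4 := c.next (by omega)
      have i5 := a.rightmost (by omega) z
      have i6 := h.incX (i + 1) (by omega)
      have i7 : Y (e (i + 2)) ≠ Y z ∨ X (e (i + 2)) = X z := by
        by_cases hh : Y (e (i + 2)) = Y z
        · exact Or.inr (by rw [sp.injY hh])
        · exact Or.inl hh
      rw [show min (i + 2 + 1) (i + 2) = i + 2 by omega, show i + 2 + 1 - 1 = i + 2 by omega,
        show i + 2 - 1 = i + 1 by omega]
      simp only [Nat.add_assoc, Nat.reduceAdd] at *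
      omega
    · rw [nxt_of_le hk', show min k N = k by omega]
      cases k with
      | zero =>
        have hs1 : ¬ σ 1 := by have := h.alt 0 (by omega); tauto
        have hs2 : σ 2 := by have := h.alt 1 (by omega); tauto
        have b := he' 1 (by omega) hs1
        have c := he 2 (by omega) hs2
        have i1 := a.next (by omega)
        have i2 := a.lowest (by omega) z
        have i3 := b.lowest le_rfl z
        have i4 := c.prev 0 rfl
        have i6 : X (e 1) ≠ X z ∨ Y (e 1) = Y z := by
          by_cases hh : X (e 1) = X z
          · exact Or.inr (by rw [sp.injX hh])
          · exact Or.inl hh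
        have i7 := b.next (by omega)
        have i8 := h.incY 1 (by omega)
        rw [prv_zero]
        simp only [zero_add, zero_le, Nat.zero_sub, Nat.reduceAdd] at *
        omega
      | succ j =>
        have hs0 : ¬ σ j := by have := h.alt j (by omega); tauto
        have hs2 : ¬ σ (j + 2) := by have := h.alt (j + 1) (by omega); tauto
        have b := he' j (by omega) hs0
        have c := he' (j + 2) (by omega) hs2
        have i1 := b.next hk'
        have i2 := c.prev j rfl
        rw [prv_succ, Nat.add_sub_cancel]
        -- For `j + 1 = N` the right boundary is the frame. The rightmost point `e N` then replaces
        -- it; `z` is another point because `e N` has height `py j`.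
        have i3 : X z < px (j + 2) → py j < Y z → X z < X (e (j + 1)) := by
          intro h1 h2
          by_cases hkN : j + 1 + 1 ≤ N
          · rw [a.next hkN]; exact h1
          · have := a.rightmost (by omega) z
            obtain ⟨j, rfl⟩ : ∃ i, j = i + 1 := ⟨j - 1, by omega⟩
            have := a.prev j rfl
            omega
        have i4 : X z < X (e (j + 1)) → X z < px (j + 2) := by
          intro h1
          by_cases hkN : j + 1 + 1 ≤ N
          · rwa [← a.next hkN]
          · obtain rfl : N = j + 1 := by omega
            exact bX.2
        have i5 : X z < X (e (j + 1)) → (py j < Y z ↔ Y (e (j + 1)) < Y z) := by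
          intro h1
          cases j with
          | zero => have := a.lowest le_rfl z; simp only [zero_add] at *; omega
          | succ j => rw [a.prev j rfl]
        simp only [Nat.add_assoc, Nat.reduceAdd] at *
        constructor
        · rintro ⟨h1, h2, h3, h4⟩
          have h5 := i3 h2 h3
          exact ⟨by omega, h5, (i5 h5).1 h3, by omega⟩
        · rintro ⟨h1, h2, h3, h4⟩
          exact ⟨by omega, i4 h2, (i5 h2).2 h3, by omega⟩
  · intro k hk hs z
    have hs0 : ¬ σ k := by have := h.alt k (by omega); tauto
    have hs2 : ¬ σ (k + 2) := by have := h.alt (k + 1) (by omega); tauto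
    have hs3 : σ (k + 3) := by have := h.alt (k + 2) (by omega); tauto
    rw [hS (k + 1) (by omega) (by omega), (he' k (by omega) hs0).next (by omega),
      (he' (k + 2) (by omega) hs2).prev k rfl, (he (k + 1) (by omega) hs).next (by omega),
      (he (k + 3) (by omega) hs3).prev (k + 1) rfl]

theorem exists_staircase [Finite α] [Nonempty α] (h : InflectionSequence X Y N σ px py)
    (sp : SimplePoints X Y) {C S : ℕ → α → Prop}
    (hC : ∀ k, k ≤ N + 1 → σ k → ∀ z, C k z ↔ px (min k N) < X z ∧ X z < px (min k N + 1) ∧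
      py (k - 1) < Y z ∧ Y z < py (k - 1 + 1))
    (hC' : ∀ k, k ≤ N + 1 → ¬ σ k → ∀ z, C k z ↔ py (min k N) < Y z ∧ Y z < py (min k N + 1) ∧
      px (k - 1) < X z ∧ X z < px (k - 1 + 1))
    (hS : ∀ k, 1 ≤ k → k < N → ∀ z, S k z ↔ px k < X z ∧ X z < px (k + 1) ∧
      py k < Y z ∧ Y z < py (k + 1)) : ∃ e, Staircase X Y N σ e C S := by
  have hex : ∀ k, ∃ a, k ≤ N + 1 → (σ k → CornerPoint X Y N px py k a) ∧
      (¬ σ k → CornerPoint Y X N py px k a) := by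
    intro k
    by_cases hk : k ≤ N + 1
    · by_cases hs : σ k
      · obtain ⟨a, ha⟩ := h.exists_cornerPoint sp hk hs
        exact ⟨a, fun _ => ⟨fun _ => ha, fun hn => absurd hs hn⟩⟩
      · obtain ⟨a, ha⟩ := h.swap.exists_cornerPoint sp.swap hk hs
        exact ⟨a, fun _ => ⟨fun hn => absurd hn hs, fun _ => ha⟩⟩
    · exact ⟨Classical.arbitrary α, fun hn => absurd hn hk⟩
  choose e he using hex
  refine ⟨e, sp.injX, sp.injY, h.two_le sp, h.alt,
    h.halfStaircase sp (fun k hk => (he k hk).1) (fun k hk => (he k hk).2) hC hS,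
    h.swap.halfStaircase sp.swap (fun k hk => (he k hk).2)
      (fun k hk hs => (he k hk).1 (not_not.1 hs)) hC' fun k h1 hk z => ?_⟩
  rw [hS k h1 hk]
  tauto

end InflectionSequence

/-! ### Comparability and alternation of inflections. -/

theorem rlMin_lt_iff {X Y : α → ℤ} (hX : Function.Injective X) {a b : α} (ha : RLMin X Y a)
    (hb : RLMin X Y b) : X a < X b ↔ Y a < Y b := by
  refine ⟨ha b, fun h => ?_⟩
  rcases lt_trichotomy (X a) (X b) with h1 | h1 | h1
  · exact h1
  · have := hX h1
    subst this
    omega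
  · have := hb a h1
    omega

/-- Distinct steps of one path do not overlap: the later one starts no earlier than the former ends,
since no r-l min lies between consecutive ones. -/
theorem SimplePoints.minInflection_comparable {X Y : α → ℤ} (sp : SimplePoints X Y)
    {x y x' y' : ℤ} (h : MinInflection X Y x y) (h' : MinInflection X Y x' y') :
    (x = x' ∧ y = y') ∨ (x < x' ∧ y < y') ∨ (x' < x ∧ y' < y) := by
  have key : ∀ i j i' j', RLMin X Y j → RLMin X Y i' → RLMin X Y j' →
      (∀ k, X i < X k → X k < X j → ¬ RLMin X Y k) → X i < X i' → X i' < X j' → Y j < Y j' := by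
    intro i j i' j' hj hi' hj' hb hlt hlt'
    have : X j ≤ X i' := by
      by_contra hc
      exact hb i' hlt (by omega) hi'
    exact hj j' (by omega)
  obtain ⟨i, j, hi, hj, hij, hb, rfl, rfl⟩ := h
  obtain ⟨i', j', hi', hj', hij', hb', rfl, rfl⟩ := h'
  rcases lt_trichotomy (X i) (X i') with hlt | heq | hlt
  · exact Or.inr (Or.inl ⟨hlt, key i j i' j' hj hi' hj' hb hlt hij'⟩)
  · left
    refine ⟨heq, ?_⟩
    have : X j = X j' := by
      rcases lt_trichotomy (X j) (X j') with h1 | h1 | h1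
      · exact absurd hj (hb' j (by omega) h1)
      · exact h1
      · exact absurd hj' (hb j' (by omega) h1)
    rw [sp.injX this]
  · exact Or.inr (Or.inr ⟨hlt, key i' j' i j hj' hi hj hb' hlt hij⟩)

theorem SimplePoints.not_maxInflection {X Y : α → ℤ} (sp : SimplePoints X Y)
    {x y : ℤ} (h : MinInflection X Y x y) : ¬ MinInflection Y X y x := by
  rintro ⟨M, M', -, hM', -, -, -, hx⟩
  obtain ⟨i, j, hi, -, -, -, hx', -⟩ := h
  have : M' = i := sp.injX (by rw [← hx, hx'])
  subst this
  exact sp.not_rlMin_swap hi hM'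

/-- If the entries up to the abscissa of `i` are lower than those beyond it, then there are no
entries beyond it. -/
theorem SimplePoints.no_cut {X Y : α → ℤ} (sp : SimplePoints X Y) {i j : α} {y : ℤ}
    (hij : X i < X j) (h1 : ∀ z, X z ≤ X i → Y z < y) (h2 : ∀ z, X i < X z → y ≤ Y z) : False := by
  have hinc : ∀ b c, X b ≤ X i → ¬ X c ≤ X i → Inc X Y b c := fun b c hb hc =>
    ⟨by omega, (h1 b hb).trans_le (h2 c (not_le.1 hc))⟩
  rcases sp.cut (fun b => X b ≤ X i) hinc with h | h
  · exact absurd (h j) (not_le.2 hij)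
  · exact absurd le_rfl (h i)

/-- If the max inflection is to the upper left, the four points `M`, `M'`, `i`, `j` form 3412. If it
is to the lower right, everything up to `i` is below everything beyond it, a direct sum. -/
theorem SimplePoints.min_max_comparable [Finite α] {X Y : α → ℤ} (sp : SimplePoints X Y)
    (av : Avoids X Y) {x y x' y' : ℤ} (h : MinInflection X Y x y) (h' : MinInflection Y X y' x') :
    (x < x' ∧ y < y') ∨ (x' < x ∧ y' < y) := by
  obtain ⟨i, j, hi, hj, hij, hb, rfl, rfl⟩ := h
  obtain ⟨M, M', hM, hM', hMM, hb', rfl, rfl⟩ := h'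
  have n1 : X M' ≠ X i := fun hh => by
    have := sp.injX hh; subst this; exact sp.not_rlMin_swap hi hM'
  have n2 : Y M ≠ Y j := fun hh => by
    have := sp.injY hh; subst this; exact sp.not_rlMin_swap hj hM
  rcases lt_or_gt_of_ne n1 with h1 | h1
  · refine Or.inr ⟨h1, ?_⟩
    by_contra hc
    exact av.no3412 M M' i j (hM M' hMM) h1 hij (hi j hij) (by omega) hMM
  · refine Or.inl ⟨h1, ?_⟩
    by_contra hc
    refine sp.no_cut hij (y := Y j) (fun z hz => ?_)
      fun z hz => le_of_consecutive hj hb sp.injX hz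
    by_contra hlt
    have := le_of_consecutive (z := z) hM' hb' sp.injY (by omega)
    omega

/-- Between two inflections of the right-to-left minimum path there is an inflection of the
left-to-right maximum path. -/
theorem SimplePoints.exists_max_between [Finite α] {X Y : α → ℤ} (sp : SimplePoints X Y)
    (av : Avoids X Y) {x y x' y' : ℤ} (h : MinInflection X Y x y) (h' : MinInflection X Y x' y')
    (hlt : x < x') : ∃ a b, MinInflection Y X b a ∧ x < a ∧ a < x' ∧ y < b ∧ b < y' := by
  obtain ⟨i, j, hi, hj, hij, hb, rfl, rfl⟩ := h
  obtain ⟨i', j', hi', hj', hij', hb', rfl, rfl⟩ := h'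
  have hji : X j ≤ X i' := by
    by_contra hc
    exact hb i' hlt (by omega) hi'
  have hY1 := hi j hij
  have hY2 := hj j' (by omega)
  obtain ⟨z, hz, hzY⟩ : ∃ z, X z < X i ∧ Y j < Y z := by
    by_contra! hc
    refine sp.no_cut hij (y := Y j) (fun z hz => ?_)
      fun z hz => le_of_consecutive hj hb sp.injX hz
    rcases hz.eq_or_lt with hz | hz
    · rw [sp.injX hz]; exact hY1
    · have := hc z hz
      have : Y z ≠ Y j := fun hh => by have := sp.injY hh; subst this; omega
      omega
  -- The inflection sought is between `M`, the highest point left of `i`, and the next l-r max `M'`.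
  -- Absence of a cut at `i` puts `M` above `j`; absence of a cut at `i'` will put `M'` left of
  -- `i'`.
  obtain ⟨M, hMX, hmax⟩ := Set.exists_max_image {z | X z < X i} Y (Set.toFinite _) ⟨z, hz⟩
  have hMX : X M < X i := hMX
  have hMY := hmax z hz
  have hM : RLMin Y X M := fun b hb => by
    by_contra hc
    have := hmax b (show X b < X i by omega)
    omega
  have hMj : Y M < Y j' := by
    by_contra hc
    have : Y M ≠ Y j' := fun hh => by have := sp.injY hh; subst this; omega
    exact av.no4123 M i j j' hMX hij (by omega) hY1 hY2 (by omega)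
  obtain ⟨r, hr, hr1, -⟩ := exists_rlMin Y X j'
  obtain ⟨M', ⟨hM', hMM⟩, hmin⟩ := Set.exists_min_image {r | RLMin Y X r ∧ Y M < Y r} Y
    (Set.toFinite _) ⟨r, hr, by omega⟩
  have hbM : ∀ k, Y M < Y k → Y k < Y M' → ¬ RLMin Y X k := fun k h1 h2 h3 => by
    have := hmin k ⟨h3, h1⟩
    omega
  have hMi : X M' ≠ X i := fun hh => by
    have := sp.injX hh; subst this; exact sp.not_rlMin_swap hi hM'
  have hMi' : X M' ≠ X i' := fun hh => by
    have := sp.injX hh; subst this; exact sp.not_rlMin_swap hi' hM'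
  refine ⟨X M', Y M, ⟨M, M', hM, hM', hMM, hbM, rfl, rfl⟩, ?_, ?_, by omega, hMj⟩
  · by_contra hc
    have := hmax M' (show X M' < X i by omega)
    omega
  · by_contra hc
    refine sp.no_cut hij' (y := Y j') (fun z hz => ?_)
      fun z hz => le_of_consecutive hj' hb' sp.injX hz
    by_contra hlt
    have := le_of_consecutive (z := z) hM' hbM sp.injY (by omega)
    omega

/-! ### Enumerating chains and alternations. -/

theorem exists_enumeration [Finite α] {X : α → ℤ} (hX : Function.Injective X) (A : α → Prop) :
    ∃ (m : ℕ) (a : Fin m → α), (∀ z, A z ↔ ∃ s, a s = z) ∧ StrictMono fun s => X (a s) := by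
  classical
  have : Fintype α := Fintype.ofFinite α
  set F := (Finset.univ.filter A).image X with hF
  have hex : ∀ s, ∃ z, A z ∧ X z = F.orderEmbOfFin rfl s := fun s => by
    obtain ⟨z, hz, hzs⟩ := Finset.mem_image.1 (F.orderEmbOfFin_mem rfl s)
    exact ⟨z, (Finset.mem_filter.1 hz).2, hzs⟩
  choose a ha haX using hex
  refine ⟨F.card, a, fun z => ⟨fun hz => ?_, ?_⟩, fun s t hst => ?_⟩
  · have hzF : X z ∈ Set.range (F.orderEmbOfFin rfl) := by
      rw [Finset.range_orderEmbOfFin]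
      simp only [hF, Finset.coe_image, Finset.coe_filter]
      exact ⟨z, by simpa using hz, rfl⟩
    obtain ⟨s, hs⟩ := hzF
    exact ⟨s, hX (by rw [haX, hs])⟩
  · rintro ⟨s, rfl⟩
    exact ha s
  · simp only [haX]
    exact (F.orderEmbOfFin rfl).strictMono hst

/-- Match each element of `A` with the next element of `B` after it; alternation makes this an
order-preserving bijection. -/
theorem Alternate.exists_enumeration [Finite α] {X : α → ℤ} (hX : Function.Injective X)
    {A B : α → Prop} (h : Alternate X A B) : ∃ (m : ℕ) (a b : Fin m → α),
      (∀ z, A z ↔ ∃ s, a s = z) ∧ (∀ z, B z ↔ ∃ s, b s = z) ∧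
      (StrictMono fun s => X (a s)) ∧ (StrictMono fun s => X (b s)) ∧
      ∀ s t, X (a s) < X (b t) ↔ s ≤ t := by
  obtain ⟨m, a, ha, hmono⟩ := PermClass.exists_enumeration hX A
  have hex : ∀ s, ∃ b, B b ∧ X (a s) < X b ∧ ∀ b', B b' → X (a s) < X b' → X b ≤ X b' := by
    intro s
    obtain ⟨b, ⟨hb, hb1⟩, hmin⟩ := Set.exists_min_image {b | B b ∧ X (a s) < X b} X
      (Set.toFinite _) (h.after (a s) ((ha _).2 ⟨s, rfl⟩))
    exact ⟨b, hb, hb1, fun b' h1 h2 => hmin b' ⟨h1, h2⟩⟩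
  choose b hb hab hmin using hex
  have hlt : ∀ s t, s < t → X (b s) < X (a t) := fun s t hst => by
    obtain ⟨c, hc, h1, h2⟩ := h.left (a s) (a t) ((ha _).2 ⟨s, rfl⟩) ((ha _).2 ⟨t, rfl⟩)
      (hmono hst)
    exact (hmin s c hc h1).trans_lt h2
  refine ⟨m, a, b, ha, fun z => ⟨fun hz => ?_, ?_⟩, hmono, fun s t hst =>
    (hlt s t hst).trans (hab t), fun s t => ⟨fun hst => ?_, fun hst => ?_⟩⟩
  · obtain ⟨c, ⟨hc, hcz⟩, hmax⟩ := Set.exists_max_image {c | A c ∧ X c < X z} X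
      (Set.toFinite _) (h.before z hz)
    obtain ⟨s, rfl⟩ := (ha c).1 hc
    refine ⟨s, hX ?_⟩
    have h1 := hmin s z hz hcz
    by_contra hne
    obtain ⟨c', hc', h2, h3⟩ := h.right (b s) z (hb s) hz (by omega)
    have := hmax c' ⟨hc', h3⟩
    have := hab s
    omega
  · rintro ⟨s, rfl⟩
    exact hb s
  · by_contra hc
    have := hlt t s (not_le.1 hc)
    omega
  · exact (hmono.monotone hst).trans_lt (hab t)

end Points

/-- A finite set of points of which any two are comparable can be listed in increasing order. -/
theorem exists_increasing_list {I : Set (ℕ × ℕ)} (hI : I.Finite) {a b : ℕ × ℕ}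
    (hab : a.1 < b.1 ∧ a.2 < b.2)
    (hchain : ∀ q ∈ I, ∀ q' ∈ I, q = q' ∨ (q.1 < q'.1 ∧ q.2 < q'.2) ∨ (q'.1 < q.1 ∧ q'.2 < q.2))
    (ha : ∀ q ∈ I, a.1 < q.1 ∧ a.2 < q.2) (hb : ∀ q ∈ I, q.1 < b.1 ∧ q.2 < b.2) :
    ∃ (N : ℕ) (p : ℕ → ℕ × ℕ), p 0 = a ∧ p (N + 1) = b ∧
      (∀ k, k ≤ N → (p k).1 < (p (k + 1)).1 ∧ (p k).2 < (p (k + 1)).2) ∧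
      ∀ q, q ∈ I ↔ ∃ k, 1 ≤ k ∧ k ≤ N ∧ p k = q := by
  classical
  have : Finite I := hI
  obtain ⟨N, f, hf, hmono⟩ := exists_enumeration (α := I) (X := fun q => ((q : ℕ × ℕ).1 : ℤ))
    (fun q q' h => by
      have h : (q : ℕ × ℕ).1 = (q' : ℕ × ℕ).1 := Nat.cast_injective (R := ℤ) h
      rcases hchain q q.2 q' q'.2 with h1 | h1 | h1
      · exact Subtype.ext h1
      · omega
      · omega) (fun _ => True)
  let p : ℕ → ℕ × ℕ := fun k =>
    if k = 0 then a else if h : k - 1 < N then (f ⟨k - 1, h⟩ : ℕ × ℕ) else b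
  have hp : ∀ k (h : k < N), p (k + 1) = f ⟨k, h⟩ := fun k h => by simp [p, h]
  have hpN : p (N + 1) = b := by simp [p]
  refine ⟨N, p, by simp [p], hpN, fun k hk => ?_, fun q => ⟨fun hq => ?_, ?_⟩⟩
  · cases k with
    | zero =>
      rcases Nat.eq_zero_or_pos N with rfl | hN
      · rw [hpN]; simpa [p] using hab
      · rw [hp 0 hN]
        simpa [p] using ha _ (f ⟨0, hN⟩).2
    | succ k =>
      rw [hp k hk]
      rcases Nat.lt_or_ge (k + 1) N with hk' | hk'
      · rw [hp (k + 1) hk']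
        have h1 : ((f ⟨k, hk⟩ : ℕ × ℕ).1 : ℤ) < ((f ⟨k + 1, hk'⟩ : ℕ × ℕ).1 : ℤ) :=
          hmono (a := ⟨k, hk⟩) (b := ⟨k + 1, hk'⟩) (by simp [Fin.lt_def])
        rcases hchain _ (f ⟨k, hk⟩).2 _ (f ⟨k + 1, hk'⟩).2 with h2 | h2 | h2
        · rw [h2] at h1; omega
        · exact h2
        · omega
      · rw [show k + 1 + 1 = N + 1 by omega, hpN]
        exact hb _ (f ⟨k, hk⟩).2
  · obtain ⟨s, hs⟩ := (hf ⟨q, hq⟩).1 trivial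
    exact ⟨s + 1, by omega, s.2, by rw [hp s s.2, Fin.eta, hs]⟩
  · rintro ⟨k, h1, hk, rfl⟩
    obtain ⟨k, rfl⟩ : ∃ j, k = j + 1 := ⟨k - 1, by omega⟩
    rw [hp k hk]
    exact (f ⟨k, hk⟩).2

/-! ### Permutations as point sets. -/

variable {n : ℕ}

/-- The abscissa of an entry as an integer. -/
def xz (i : Fin n) : ℤ := xc i

/-- The ordinate of an entry as an integer. -/
def yz (π : Equiv.Perm (Fin n)) (i : Fin n) : ℤ := yc π i

theorem xz_lt_iff {i j : Fin n} : xz i < xz j ↔ i < j := by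
  simp only [xz, xc, Fin.lt_def]; omega

theorem yz_lt_iff {π : Equiv.Perm (Fin n)} {i j : Fin n} : yz π i < yz π j ↔ π i < π j := by
  simp only [yz, yc, Fin.lt_def]; omega

theorem xz_le_iff {i j : Fin n} : xz i ≤ xz j ↔ i ≤ j := by
  simp only [xz, xc, Fin.le_def]; omega

theorem yz_le_iff {π : Equiv.Perm (Fin n)} {i j : Fin n} : yz π i ≤ yz π j ↔ π i ≤ π j := by
  simp only [yz, yc, Fin.le_def]; omega

theorem xz_injective : Function.Injective (xz : Fin n → ℤ) := fun i j h => by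
  simpa [xz, xc, Fin.ext_iff] using h

theorem yz_injective (π : Equiv.Perm (Fin n)) : Function.Injective (yz π) := fun i j h => by
  simpa [yz, yc, ← Fin.ext_iff] using h

theorem inAv_iff_avoids (π : Equiv.Perm (Fin n)) : InAv π ↔ Avoids xz (yz π) := by
  have key : ∀ (w : Fin 4 → ℕ), Contains π w ↔ ∃ a b c d : Fin n, a < b ∧ b < c ∧ c < d ∧
      ∀ s t, π (![a, b, c, d] s) < π (![a, b, c, d] t) ↔ w s < w t := by
    intro w
    constructor
    · rintro ⟨f, hf, hw⟩
      refine ⟨f 0, f 1, f 2, f 3, hf (by decide), hf (by decide), hf (by decide), ?_⟩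
      have : ![f 0, f 1, f 2, f 3] = f := by
        ext s; fin_cases s <;> rfl
      rwa [this]
    · rintro ⟨a, b, c, d, h1, h2, h3, hw⟩
      refine ⟨![a, b, c, d], ?_, hw⟩
      rw [Fin.strictMono_iff_lt_succ]
      intro i
      fin_cases i
      · exact h1
      · exact h2
      · exact h3
  simp only [InAv, key, Fin.forall_fin_succ, Fin.forall_fin_zero]
  constructor
  · rintro ⟨h1, h2, h3⟩
    constructor
    · intro a b c d i1 i2 i3 i4 i5 i6
      rw [xz_lt_iff] at i1 i2 i3
      rw [yz_lt_iff] at i4 i5 i6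
      refine h1 ⟨a, b, c, d, i1, i2, i3, ?_⟩
      simp
      omega
    · intro a b c d i1 i2 i3 i4 i5 i6
      rw [xz_lt_iff] at i1 i2 i3
      rw [yz_lt_iff] at i4 i5 i6
      refine h2 ⟨a, b, c, d, i1, i2, i3, ?_⟩
      simp
      omega
    · intro a b c d i1 i2 i3 i4 i5 i6
      rw [xz_lt_iff] at i1 i2 i3
      rw [yz_lt_iff] at i4 i5 i6
      refine h3 ⟨a, b, c, d, i1, i2, i3, ?_⟩
      simp
      omega
  · intro h
    refine ⟨?_, ?_, ?_⟩
    · rintro ⟨a, b, c, d, i1, i2, i3, hw⟩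
      simp at hw
      refine h.no2341 a b c d (xz_lt_iff.2 i1) (xz_lt_iff.2 i2) (xz_lt_iff.2 i3) ?_ ?_ ?_ <;>
        rw [yz_lt_iff] <;> tauto
    · rintro ⟨a, b, c, d, i1, i2, i3, hw⟩
      simp at hw
      refine h.no4123 a b c d (xz_lt_iff.2 i1) (xz_lt_iff.2 i2) (xz_lt_iff.2 i3) ?_ ?_ ?_ <;>
        rw [yz_lt_iff] <;> tauto
    · rintro ⟨a, b, c, d, i1, i2, i3, hw⟩
      simp at hw
      refine h.no3412 a b c d (xz_lt_iff.2 i1) (xz_lt_iff.2 i2) (xz_lt_iff.2 i3) ?_ ?_ ?_ <;>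
        rw [yz_lt_iff] <;> tauto

/-! ### Geometric consequences of simplicity. -/

theorem exists_Icc_eq_ne (hn : 2 < n) {z : Fin n} (hz : (∀ x, x ≤ z) ∨ ∀ x, z ≤ x) :
    ∃ a b : Fin n, a < b ∧ ∀ x, x ∈ Finset.Icc a b ↔ x ≠ z := by
  rcases hz with hz | hz
  · have h1 := hz ⟨n - 1, by omega⟩
    refine ⟨⟨0, by omega⟩, ⟨n - 2, by omega⟩, ?_, fun x => ?_⟩
    · simp only [Fin.lt_def]; omega
    · have := hz x
      simp only [Finset.mem_Icc, Fin.le_def, ne_eq, Fin.ext_iff] at *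
      omega
  · have h1 := hz ⟨0, by omega⟩
    refine ⟨⟨1, by omega⟩, ⟨n - 1, by omega⟩, ?_, fun x => ?_⟩
    · simp only [Fin.lt_def]; omega
    · have := hz x
      simp only [Finset.mem_Icc, Fin.le_def, ne_eq, Fin.ext_iff] at *
      omega

/-- In a simple permutation no entry is extreme both horizontally and vertically. -/
theorem IsSimple.not_extreme (hn : 2 < n) {π : Equiv.Perm (Fin n)} (hπ : IsSimple π) {z : Fin n}
    (hx : (∀ x, x ≤ z) ∨ ∀ x, z ≤ x) (hy : (∀ y, y ≤ π z) ∨ ∀ y, π z ≤ y) : False := by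
  obtain ⟨a, b, hab, h1⟩ := exists_Icc_eq_ne hn hx
  obtain ⟨u, v, -, h2⟩ := exists_Icc_eq_ne hn hy
  have hI : IsInterval π a b := by
    refine ⟨hab.le, u, v, ?_⟩
    ext y
    rw [h2, Finset.mem_image]
    constructor
    · rintro ⟨x, hx, rfl⟩
      exact π.injective.ne ((h1 x).1 hx)
    · intro hy
      refine ⟨π.symm y, (h1 _).2 ?_, π.apply_symm_apply y⟩
      rintro rfl
      exact hy (π.apply_symm_apply y).symm
  rcases hπ _ _ hI with h | h
  · exact hab.ne h
  · exact (h1 z).1 (h ▸ Finset.mem_univ z) rfl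

theorem IsSimple.exists_separating (hn : 2 < n) {π : Equiv.Perm (Fin n)} (hπ : IsSimple π)
    {a b : Fin n} (hab : a < b) : ∃ c, (a < c ∧ c < b) ∨
      (π a < π c ∧ π c < π b) ∨ (π b < π c ∧ π c < π a) := by
  by_contra! hc
  have hne : π a ≠ π b := π.injective.ne hab.ne
  have hIcc : ∀ x, x ∈ Finset.Icc a b ↔ x = a ∨ x = b := fun x => by
    have := (hc x).1
    simp only [Finset.mem_Icc, Fin.le_def, Fin.lt_def, Fin.ext_iff] at *
    omega
  have hI : IsInterval π a b := by
    refine ⟨hab.le, min (π a) (π b), max (π a) (π b), ?_⟩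
    ext y
    have h1 := (hc (π.symm y)).2
    rw [π.apply_symm_apply] at h1
    rw [Finset.mem_image]
    have h2 : (∃ x ∈ Finset.Icc a b, π x = y) ↔ y = π a ∨ y = π b := by
      simp only [hIcc]
      constructor
      · rintro ⟨x, rfl | rfl, rfl⟩ <;> simp
      · rintro (rfl | rfl)
        · exact ⟨a, Or.inl rfl, rfl⟩
        · exact ⟨b, Or.inr rfl, rfl⟩
    rw [h2]
    clear h2 hIcc hc hab hπ
    simp only [Finset.mem_Icc, min_le_iff, le_max_iff, Fin.le_def, Fin.lt_def, Fin.ext_iff] at *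
    omega
  rcases hπ _ _ hI with h | h
  · exact hab.ne h
  · have hcard : (Finset.Icc a b).card ≤ 2 := by
      have : Finset.Icc a b = {a, b} := by ext x; simp [hIcc]
      rw [this]; exact Finset.card_le_two
    rw [h, Finset.card_univ, Fintype.card_fin] at hcard
    omega

/-- A lower summand would occupy initial segments of positions and of values, hence be a proper
interval. If it is a single entry, this entry is leftmost and lowest, which `IsSimple.not_extreme`
rules out. -/
theorem IsSimple.cut (hn : 2 < n) {π : Equiv.Perm (Fin n)} (hπ : IsSimple π)
    (P : Fin n → Prop) (hP : ∀ a b, P a → ¬ P b → a < b ∧ π a < π b) :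
    (∀ a, P a) ∨ ∀ a, ¬ P a := by
  by_contra! hc
  obtain ⟨⟨b, hb⟩, a, ha⟩ := hc
  obtain ⟨m, hm, hmax⟩ := Set.exists_max_image {x | P x} id (Set.toFinite _) ⟨a, ha⟩
  obtain ⟨v, hv, hvmax⟩ := Set.exists_max_image {x | P x} π (Set.toFinite _) ⟨a, ha⟩
  have h1 : ∀ x, x ≤ m ↔ P x := fun x =>
    ⟨fun hx => by by_contra hc; exact absurd (hP m x hm hc).1 hx.not_gt, fun hx => hmax x hx⟩
  have h2 : ∀ x, π x ≤ π v ↔ P x := fun x =>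
    ⟨fun hx => by by_contra hc; exact absurd (hP v x hv hc).2 hx.not_gt, fun hx => hvmax x hx⟩
  have h0 : ∀ x : Fin n, (⟨0, by omega⟩ : Fin n) ≤ x := fun x => by simp [Fin.le_def]
  have hI : IsInterval π ⟨0, by omega⟩ m := by
    refine ⟨h0 m, ⟨0, by omega⟩, π v, ?_⟩
    ext y
    rw [Finset.mem_image, Finset.mem_Icc]
    constructor
    · rintro ⟨x, hx, rfl⟩
      exact ⟨h0 _, (h2 x).2 ((h1 x).1 (Finset.mem_Icc.1 hx).2)⟩
    · rintro ⟨-, hy⟩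
      refine ⟨π.symm y, Finset.mem_Icc.2 ⟨h0 _, (h1 _).2 ((h2 _).1 ?_)⟩, π.apply_symm_apply y⟩
      rwa [π.apply_symm_apply]
  rcases hπ _ _ hI with h | h
  · have hP0 : ∀ x, P x → x = m := fun x hx => by
      have h3 := (h1 x).2 hx
      have h4 := h0 x
      rw [h] at h4
      exact le_antisymm h3 h4
    refine hπ.not_extreme hn (z := m) (Or.inr (h ▸ h0)) (Or.inr fun y => ?_)
    by_cases hy : P (π.symm y)
    · rw [← hP0 _ hy, π.apply_symm_apply]
    · have := (hP m _ hm hy).2.le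
      rwa [π.apply_symm_apply] at this
  · have := Finset.mem_univ b
    rw [← h, Finset.mem_Icc, h1] at this
    exact hb this.2

theorem IsSimple.simplePoints (hn : 2 < n) {π : Equiv.Perm (Fin n)} (hπ : IsSimple π) :
    SimplePoints xz (yz π) where
  injX := xz_injective
  injY := yz_injective π
  sep a b hab := by
    simp only [xz_lt_iff, yz_lt_iff]
    rcases lt_or_gt_of_ne hab with h | h
    · obtain ⟨c, hc⟩ := hπ.exists_separating hn h
      exact ⟨c, by tauto⟩
    · obtain ⟨c, hc⟩ := hπ.exists_separating hn h
      exact ⟨c, by tauto⟩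
  cut P hP := hπ.cut hn P fun a b ha hb => by
    have := hP a b ha hb
    rwa [Inc, xz_lt_iff, yz_lt_iff] at this
  lowerRight z h1 h2 := by
    simp only [xz_le_iff, yz_le_iff] at h1 h2
    refine hπ.not_extreme hn (z := z) (Or.inl h1) (Or.inr fun y => ?_)
    have := h2 (π.symm y)
    rwa [π.apply_symm_apply] at this
  upperLeft z h1 h2 := by
    simp only [xz_le_iff, yz_le_iff] at h1 h2
    refine hπ.not_extreme hn (z := z) (Or.inr h1) (Or.inl fun y => ?_)
    have := h2 (π.symm y)
    rwa [π.apply_symm_apply] at this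

/-! ### Inflections and cells of a permutation. -/

theorem isRLMin_iff {π : Equiv.Perm (Fin n)} {i : Fin n} : IsRLMin π i ↔ RLMin xz (yz π) i := by
  simp only [IsRLMin, RLMin, xz_lt_iff, yz_lt_iff]

theorem isLRMax_iff {π : Equiv.Perm (Fin n)} {i : Fin n} : IsLRMax π i ↔ RLMin (yz π) xz i := by
  simp only [IsLRMax, RLMin, xz_lt_iff, yz_lt_iff]
  constructor
  · intro h b hb
    by_contra hc
    rcases (not_lt.1 hc).eq_or_lt with h1 | h1
    · exact hb.ne (by rw [h1])
    · exact (h b h1).not_gt hb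
  · intro h b hb
    by_contra hc
    rcases (not_lt.1 hc).eq_or_lt with h1 | h1
    · exact hb.ne (π.injective h1).symm
    · exact (h b h1).not_gt hb

theorem isMinInflection_iff {π : Equiv.Perm (Fin n)} {q : ℕ × ℕ} :
    IsMinInflection π q ↔ MinInflection xz (yz π) q.1 q.2 := by
  simp only [IsMinInflection, MinInflection, isRLMin_iff, ← xz_lt_iff, Prod.ext_iff, Nat.cast_inj,
    show ∀ i : Fin n, xz i = (xc i : ℤ) from fun _ => rfl,
    show ∀ i : Fin n, yz π i = (yc π i : ℤ) from fun _ => rfl]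

theorem isMaxInflection_iff {π : Equiv.Perm (Fin n)} {q : ℕ × ℕ} :
    IsMaxInflection π q ↔ MinInflection (yz π) xz q.2 q.1 := by
  simp only [IsMaxInflection, MinInflection, isLRMax_iff]
  have key : ∀ i j, RLMin (yz π) xz i → RLMin (yz π) xz j → (i < j ↔ yz π i < yz π j) :=
    fun i j hi hj => by rw [rlMin_lt_iff (yz_injective π) hi hj, xz_lt_iff]
  refine exists₂_congr fun i j => and_congr_right fun hi => and_congr_right fun hj => ?_
  rw [key i j hi hj]
  refine and_congr_right fun _ => and_congr ?_ ?_
  · constructor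
    · exact fun h k h1 h2 hk => h k ((key i k hi hk).2 h1) ((key k j hk hj).2 h2) hk
    · exact fun h k h1 h2 hk => h k ((key i k hi hk).1 h1) ((key k j hk hj).1 h2) hk
  · simp only [Prod.ext_iff, xz, yz, Nat.cast_inj, and_comm]

theorem exists_coordinates {π : Equiv.Perm (Fin n)} {q : ℕ × ℕ}
    (hq : IsMaxInflection π q ∨ IsMinInflection π q) : ∃ i j : Fin n, q = (xc i, yc π j) := by
  rcases hq with ⟨i, j, -, -, -, -, rfl⟩ | ⟨i, j, -, -, -, -, rfl⟩
  · exact ⟨j, i, rfl⟩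
  · exact ⟨i, j, rfl⟩

theorem coordinate_bounds {π : Equiv.Perm (Fin n)} (i j : Fin n) :
    (0 < xc i ∧ 0 < yc π j) ∧ xc i < n + 1 ∧ yc π j < n + 1 := by
  have := i.2
  have := (π j).2
  simp only [xc, yc]
  omega

theorem not_isMaxInflection {π : Equiv.Perm (Fin n)} (sp : SimplePoints xz (yz π)) {q : ℕ × ℕ}
    (h : IsMinInflection π q) : ¬ IsMaxInflection π q := by
  rw [isMaxInflection_iff]
  exact sp.not_maxInflection (isMinInflection_iff.1 h)

theorem exists_alternatingInflections {π : Equiv.Perm (Fin n)} (sp : SimplePoints xz (yz π))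
    (av : Avoids xz (yz π)) : ∃ (N : ℕ) (p : ℕ → ℕ × ℕ), AlternatingInflections π N p := by
  obtain ⟨N, p, h0, hN, hinc, hp⟩ := exists_increasing_list
    (I := {q | IsMaxInflection π q ∨ IsMinInflection π q}) (a := (0, 0)) (b := (n + 1, n + 1))
    ((Set.finite_range fun ij : Fin n × Fin n => (xc ij.1, yc π ij.2)).subset fun q hq => by
      obtain ⟨i, j, rfl⟩ := exists_coordinates hq
      exact ⟨(i, j), rfl⟩)
    (by simp)
    (by
      rintro q hq q' hq'
      rcases hq with hq | hq <;> rcases hq' with hq' | hq'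
      · have := sp.swap.minInflection_comparable (isMaxInflection_iff.1 hq)
          (isMaxInflection_iff.1 hq')
        rw [Prod.ext_iff]
        omega
      · have := sp.min_max_comparable av (isMinInflection_iff.1 hq') (isMaxInflection_iff.1 hq)
        omega
      · have := sp.min_max_comparable av (isMinInflection_iff.1 hq) (isMaxInflection_iff.1 hq')
        omega
      · have := sp.minInflection_comparable (isMinInflection_iff.1 hq)
          (isMinInflection_iff.1 hq')
        rw [Prod.ext_iff]
        omega)
    (fun q hq => by
      obtain ⟨i, j, rfl⟩ := exists_coordinates hq
      exact (coordinate_bounds i j).1)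
    (fun q hq => by
      obtain ⟨i, j, rfl⟩ := exists_coordinates hq
      exact (coordinate_bounds i j).2)
  have hmono : ∀ k l, k ≤ l → l ≤ N + 1 → (p k).1 ≤ (p l).1 ∧ (p k).2 ≤ (p l).2 := by
    intro k l hkl hl
    induction l, hkl using Nat.le_induction with
    | base => exact ⟨le_rfl, le_rfl⟩
    | succ l hkl ih =>
      have := ih (by omega)
      have := hinc l (by omega)
      omega
  have hgap : ∀ k, k ≤ N → ∀ l, l ≤ N → ¬ ((p k).1 < (p l).1 ∧ (p l).1 < (p (k + 1)).1) ∧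
      ¬ ((p k).2 < (p l).2 ∧ (p l).2 < (p (k + 1)).2) := by
    intro k hk l hl
    rcases Nat.lt_or_ge k l with h | h
    · have := hmono (k + 1) l h (by omega)
      omega
    · have := hmono l k h (by omega)
      omega
  refine ⟨N, p, h0, hN, hinc, hp, fun k h1 hk => ?_⟩
  have e1 := (hp (p k)).2 ⟨k, h1, hk.le, rfl⟩
  have e2 := (hp (p (k + 1))).2 ⟨k + 1, by omega, hk, rfl⟩
  have hk1 := hinc k hk.le
  constructor
  -- Two successive inflections on one path would have one of the other path between them, and
  -- `hgap` leaves no place for it in the list.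
  · intro hm
    refine e2.resolve_left fun hm' => ?_
    obtain ⟨y, x, hi, h2, h3, -, -⟩ := sp.swap.exists_max_between av.swap
      (isMaxInflection_iff.1 hm) (isMaxInflection_iff.1 hm') (by exact_mod_cast hk1.2)
    obtain ⟨i, j, -, -, -, -, rfl, rfl⟩ := id hi
    obtain ⟨l, -, hl, hpl⟩ := (hp (xc i, yc π j)).1 (Or.inr (isMinInflection_iff.2 hi))
    refine (hgap k hk.le l hl).2 ?_
    rw [hpl]
    simp only [yz, Nat.cast_lt] at h2 h3
    exact ⟨h2, h3⟩
  · intro hm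
    refine e1.resolve_right fun hm' => ?_
    obtain ⟨x, y, hi, h2, h3, -, -⟩ := sp.exists_max_between av
      (isMinInflection_iff.1 hm') (isMinInflection_iff.1 hm) (by exact_mod_cast hk1.1)
    obtain ⟨i, j, -, -, -, -, rfl, rfl⟩ := id hi
    obtain ⟨l, -, hl, hpl⟩ := (hp (xc j, yc π i)).1 (Or.inl (isMaxInflection_iff.2 hi))
    refine (hgap k hk.le l hl).1 ?_
    rw [hpl]
    simp only [xz, Nat.cast_lt] at h2 h3
    exact ⟨h2, h3⟩

/-- Parity extends the distinction of kinds to the indices `0` and `N + 1`, which have corner cells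
but no inflection. -/
theorem AlternatingInflections.isMaxInflection_iff_odd {π : Equiv.Perm (Fin n)} {N : ℕ}
    {p : ℕ → ℕ × ℕ} (h : AlternatingInflections π N p) (sp : SimplePoints xz (yz π)) {k : ℕ}
    (h1 : 1 ≤ k) (hk : k ≤ N) :
    IsMaxInflection π (p k) ↔ (IsMaxInflection π (p 1) ↔ Odd k) := by
  induction k, h1 using Nat.le_induction with
  | base => simp
  | succ k h1 ih =>
    have i1 := ih (by omega)
    have i2 := h.alternate k h1 hk
    have i3 := (h.complete (p (k + 1))).2 ⟨k + 1, by omega, hk, rfl⟩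
    have i4 := not_isMaxInflection sp (q := p (k + 1))
    rw [Nat.odd_add_one]
    tauto

theorem AlternatingInflections.inflectionSequence {π : Equiv.Perm (Fin n)} {N : ℕ}
    {p : ℕ → ℕ × ℕ} (h : AlternatingInflections π N p) (sp : SimplePoints xz (yz π)) :
    InflectionSequence xz (yz π) N (fun k => (IsMaxInflection π (p 1) ↔ Odd k))
      (fun k => (p k).1) (fun k => (p k).2) where
  alt k _ := by rw [Nat.odd_add_one]; tauto
  incX k hk := by exact_mod_cast (h.increasing k hk).1
  incY k hk := by exact_mod_cast (h.increasing k hk).2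
  boundX z := by
    have := coordinate_bounds (π := π) z z
    simp only [h.first, h.last, xz]
    omega
  boundY z := by
    have := coordinate_bounds (π := π) z z
    simp only [h.first, h.last, yz]
    omega
  sound_min k h1 hk hs := by
    rw [← h.isMaxInflection_iff_odd sp h1 hk] at hs
    exact isMinInflection_iff.1 (((h.complete _).2 ⟨k, h1, hk, rfl⟩).resolve_left hs)
  sound_max k h1 hk hs := by
    rw [← h.isMaxInflection_iff_odd sp h1 hk] at hs
    exact isMaxInflection_iff.1 hs
  complete_min x y hi := by
    obtain ⟨i, j, -, -, -, -, rfl, rfl⟩ := id hi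
    have hm : IsMinInflection π (xc i, yc π j) := isMinInflection_iff.2 hi
    obtain ⟨k, h1, hk, hpk⟩ := (h.complete _).1 (Or.inr hm)
    refine ⟨k, h1, hk, ?_, by rw [hpk]; rfl, by rw [hpk]; rfl⟩
    rw [← h.isMaxInflection_iff_odd sp h1 hk, hpk]
    exact not_isMaxInflection sp hm
  complete_max y x hi := by
    obtain ⟨i, j, -, -, -, -, rfl, rfl⟩ := id hi
    have hm : IsMaxInflection π (xc j, yc π i) := isMaxInflection_iff.2 hi
    obtain ⟨k, h1, hk, hpk⟩ := (h.complete _).1 (Or.inl hm)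
    refine ⟨k, h1, hk, ?_, by rw [hpk]; rfl, by rw [hpk]; rfl⟩
    rw [← h.isMaxInflection_iff_odd sp h1 hk, hpk]
    exact hm

theorem mem_cell {π : Equiv.Perm (Fin n)} {p : ℕ → ℕ × ℕ} {c r : ℕ} {z : Fin n} :
    z ∈ cell π p c r ↔ ((p c).1 : ℤ) < xz z ∧ xz z < ((p (c + 1)).1 : ℤ) ∧
      ((p r).2 : ℤ) < yz π z ∧ yz π z < ((p (r + 1)).2 : ℤ) := by
  simp only [cell, xz, yz, Finset.mem_filter, Finset.mem_univ, true_and, Nat.cast_lt]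

theorem AlternatingInflections.exists_staircase {π : Equiv.Perm (Fin n)} {N : ℕ}
    {p : ℕ → ℕ × ℕ} (h : AlternatingInflections π N p) (sp : SimplePoints xz (yz π))
    [Nonempty (Fin n)] : ∃ e, Staircase xz (yz π) N (fun k => (IsMaxInflection π (p 1) ↔ Odd k)) e
      (fun k z => z ∈ cornerCell π N p k) (fun k z => z ∈ centralCell π p k) := by
  classical
  have hc : ∀ k, k ≤ N + 1 → cornerCell π N p k =
      if (IsMaxInflection π (p 1) ↔ Odd k) then cell π p (min k N) (k - 1)
      else cell π p (k - 1) (min k N) := by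
    intro k hk
    unfold cornerCell
    by_cases h0 : k = 0
    · subst h0
      simp
    by_cases h1 : k = N + 1
    · subst h1
      simp
    · rw [if_neg h0, if_neg h1, show min k N = k by omega]
      simp only [h.isMaxInflection_iff_odd sp (k := k) (by omega) (by omega)]
  refine (h.inflectionSequence sp).exists_staircase sp (fun k hk hs z => ?_) (fun k hk hs z => ?_)
    fun k _ _ z => mem_cell
  · simp only [hc k hk, if_pos hs]
    exact mem_cell
  · simp only [hc k hk, if_neg hs]
    rw [mem_cell]
    tauto

/-! ### The two directions for permutations. -/

theorem decreasing_iff {π : Equiv.Perm (Fin n)} {s : Finset (Fin n)} :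
    Decreasing π s ↔ ∀ i ∈ s, ∀ j ∈ s, ¬ Inc xz (yz π) i j := by
  simp only [Decreasing, Inc, xz_lt_iff, yz_lt_iff]
  refine forall₂_congr fun i hi => forall₂_congr fun j hj => ?_
  constructor
  · exact fun h hh => (h hh.1).not_gt hh.2
  · intro h hij
    by_contra hc
    rcases (not_lt.1 hc).eq_or_lt with h1 | h1
    · exact hij.ne (π.injective h1)
    · exact h ⟨hij, h1⟩

theorem Interlace.exists_inc {π : Equiv.Perm (Fin n)} {A B : Finset (Fin n)}
    (h : Interlace π A B) : ∃ a ∈ A, ∃ b ∈ B, Inc xz (yz π) a b := by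
  obtain ⟨m, hm, a, b, rfl, rfl, -, -, -, -, h⟩ := h
  refine ⟨a ⟨0, hm⟩, by simp, b ⟨0, hm⟩, by simp, ?_⟩
  rw [Inc, xz_lt_iff, yz_lt_iff]
  rcases h with ⟨h1, h2⟩ | ⟨h1, h2⟩
  · exact ⟨h1 _ _, (h2 _ _).2 le_rfl⟩
  · exact ⟨(h2 _ _).2 le_rfl, h1 _ _⟩

theorem interlace_of_alternate_horizontally {π : Equiv.Perm (Fin n)} {A B : Finset (Fin n)}
    (hA : Decreasing π A) (hB : Decreasing π B) (hne : A.Nonempty)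
    (h : Alternate xz (· ∈ A) (· ∈ B)) (hlt : ∀ a ∈ A, ∀ b ∈ B, π a < π b) :
    Interlace π A B := by
  obtain ⟨m, a, b, ha, hb, hma, hmb, hab⟩ := h.exists_enumeration xz_injective
  have haA : ∀ s, a s ∈ A := fun s => (ha _).2 ⟨s, rfl⟩
  have hbB : ∀ s, b s ∈ B := fun s => (hb _).2 ⟨s, rfl⟩
  simp only [StrictMono, xz_lt_iff] at hma hmb hab
  obtain ⟨z, hz⟩ := hne
  obtain ⟨s, -⟩ := (ha z).1 hz
  refine ⟨m, s.pos, a, b, ?_, ?_, hma, hmb, fun s t hst => hA _ (haA s) _ (haA t) (hma hst),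
    fun s t hst => hB _ (hbB s) _ (hbB t) (hmb hst),
    Or.inr ⟨fun s t => hlt _ (haA s) _ (hbB t), hab⟩⟩
  · ext z; simp [ha]
  · ext z; simp [hb]

theorem interlace_of_alternate_vertically {π : Equiv.Perm (Fin n)} {A B : Finset (Fin n)}
    (hA : Decreasing π A) (hB : Decreasing π B) (hne : A.Nonempty)
    (h : Alternate (yz π) (· ∈ A) (· ∈ B)) (hlt : ∀ a ∈ A, ∀ b ∈ B, a < b) :
    Interlace π A B := by
  obtain ⟨m, a, b, ha, hb, hma, hmb, hab⟩ := h.exists_enumeration (yz_injective π)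
  have haA : ∀ s, a s ∈ A := fun s => (ha _).2 ⟨s, rfl⟩
  have hbB : ∀ s, b s ∈ B := fun s => (hb _).2 ⟨s, rfl⟩
  simp only [StrictMono, yz_lt_iff] at hma hmb hab
  have hdec : ∀ S : Finset (Fin n), Decreasing π S → ∀ i ∈ S, ∀ j ∈ S, π i < π j → j < i := by
    intro S hS i hi j hj hij
    by_contra hc
    rcases (not_lt.1 hc).eq_or_lt with h1 | h1
    · exact hij.ne (by rw [h1])
    · exact (hS i hi j hj h1).not_gt hij
  obtain ⟨z, hz⟩ := hne
  obtain ⟨s, -⟩ := (ha z).1 hz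
  -- The enumeration goes by increasing value, while `Interlace` lists from left to right; as the
  -- cells decrease, `Fin.rev` converts one into the other.
  refine ⟨m, s.pos, a ∘ Fin.rev, b ∘ Fin.rev, ?_, ?_,
    fun s t hst => hdec A hA _ (haA _) _ (haA _) (hma (Fin.rev_lt_rev.2 hst)),
    fun s t hst => hdec B hB _ (hbB _) _ (hbB _) (hmb (Fin.rev_lt_rev.2 hst)),
    fun s t hst => hma (Fin.rev_lt_rev.2 hst), fun s t hst => hmb (Fin.rev_lt_rev.2 hst),
    Or.inl ⟨fun s t => hlt _ (haA _) _ (hbB _), fun s t => ?_⟩⟩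
  · ext z
    simp only [Finset.mem_image, Finset.mem_univ, true_and, Function.comp_apply, ha]
    exact ⟨fun ⟨s, hs⟩ => ⟨_, hs⟩, fun ⟨s, hs⟩ => ⟨s.rev, by rwa [Fin.rev_rev]⟩⟩
  · ext z
    simp only [Finset.mem_image, Finset.mem_univ, true_and, Function.comp_apply, hb]
    exact ⟨fun ⟨s, hs⟩ => ⟨_, hs⟩, fun ⟨s, hs⟩ => ⟨s.rev, by rwa [Fin.rev_rev]⟩⟩
  · simp only [Function.comp_apply, hab, Fin.rev_le_rev]

/-- The geometric conditions imply avoidance. -/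
theorem inAv_of_conditions {π : Equiv.Perm (Fin n)} [Nonempty (Fin n)]
    (sp : SimplePoints xz (yz π)) {N : ℕ}
    {p : ℕ → ℕ × ℕ} (h : AlternatingInflections π N p) (hb : CornersDecreasing π N p)
    (hc : ConsecutiveCorners π N p) (hd : CornersInterlaceOnce π N p)
    (he : CentralCells π N p) : InAv π := by
  obtain ⟨e, hs⟩ := h.exists_staircase sp
  refine (inAv_iff_avoids π).2 (hs.avoids
    (I := fun k => Interlace π (cornerCell π N p k) (cornerCell π N p (k + 1))) ⟨?_, ?_, ?_, ?_⟩)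
  · exact fun k hk a b ha hb' => decreasing_iff.1 (hb k hk) a ha b hb'
  · intro k hk
    refine (hc k hk).symm.imp_right fun hdec a b ha hb' => ?_
    exact decreasing_iff.1 hdec a (Finset.mem_union_left _ ha) b (Finset.mem_union_right _ hb')
  · intro k hk h1 h2
    obtain ⟨-, -, b, hb', -⟩ := h1.exists_inc
    rcases hd (k + 1) (by omega) ⟨b, hb'⟩ with h3 | h3
    · exact h3.2 ⟨hk, h2⟩
    · exact h3.2 ⟨by omega, h1⟩
  · intro k h1 hk
    obtain ⟨-, h2, h3⟩ := he k h1 hk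
    by_cases hI : Interlace π (cornerCell π N p k) (cornerCell π N p (k + 1))
    · exact Or.inl ⟨hI, fun z hz => by rw [h2 hI] at hz; simp at hz⟩
    · refine Or.inr fun a b ha hb' => decreasing_iff.1 (h3 hI) a ?_ b ?_
      · simpa only [Finset.mem_union, or_assoc] using ha
      · simpa only [Finset.mem_union, or_assoc] using hb'

theorem conditions_of_avoids {π : Equiv.Perm (Fin n)} [Nonempty (Fin n)]
    (sp : SimplePoints xz (yz π)) (av : Avoids xz (yz π)) {N : ℕ} {p : ℕ → ℕ × ℕ}
    (h : AlternatingInflections π N p) :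
    CornersDecreasing π N p ∧ ConsecutiveCorners π N p ∧ CornersInterlaceOnce π N p ∧
      CentralCells π N p := by
  obtain ⟨e, hs⟩ := h.exists_staircase sp
  have hdec : CornersDecreasing π N p := fun k hk =>
    decreasing_iff.2 fun a ha b hb => hs.corner_not_inc av hk ha hb
  -- Under avoidance and simplicity a single increasing pair between the cells forces the whole
  -- parallel alternation.
  have hlink : ∀ k, k ≤ N → (Interlace π (cornerCell π N p k) (cornerCell π N p (k + 1)) ↔
      Link xz (yz π) (fun k z => z ∈ cornerCell π N p k) k) := by
    intro k hk
    constructor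
    · intro hI
      obtain ⟨a, ha, b, hb, hab⟩ := hI.exists_inc
      exact ⟨a, b, ha, hb, hab⟩
    · intro hl
      obtain ⟨a, b, ha, hb, hab⟩ := id hl
      by_cases hσ : IsMaxInflection π (p 1) ↔ Odd k
      · exact interlace_of_alternate_horizontally (hdec k (by omega)) (hdec (k + 1) (by omega))
          ⟨a, ha⟩ (hs.alternate_of_link av sp hk hσ hl)
          fun a ha b hb => yz_lt_iff.1 (hs.corner_lt hk hσ ha hb)
      · exact interlace_of_alternate_vertically (hdec k (by omega)) (hdec (k + 1) (by omega))
          ⟨a, ha⟩ (hs.swap.alternate_of_link av.swap sp.swap hk hσ (link_swap.2 hl))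
          fun a ha b hb => xz_lt_iff.1 (hs.swap.corner_lt (k := k) hk hσ ha hb)
  have hnot : ∀ k, k ≤ N → ∀ a ∈ cornerCell π N p k, ∀ b ∈ cornerCell π N p (k + 1),
      ¬ Inc xz (yz π) b a := by
    intro k hk a ha b hb hi
    by_cases hσ : IsMaxInflection π (p 1) ↔ Odd k
    · exact (hs.corner_lt hk hσ ha hb).not_gt hi.2
    · exact (hs.swap.corner_lt (k := k) hk hσ ha hb).not_gt hi.1
  have hunion : ∀ k, k ≤ N → ¬ Interlace π (cornerCell π N p k) (cornerCell π N p (k + 1)) →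
      Decreasing π (cornerCell π N p k ∪ cornerCell π N p (k + 1)) := by
    intro k hk hI
    rw [hlink k hk] at hI
    rw [decreasing_iff]
    intro a ha b hb hi
    rcases Finset.mem_union.1 ha with ha | ha <;> rcases Finset.mem_union.1 hb with hb | hb
    · exact hs.corner_not_inc av (by omega) ha hb hi
    · exact hI ⟨a, b, ha, hb, hi⟩
    · exact hnot k hk b hb a ha hi
    · exact hs.corner_not_inc av (by omega) ha hb hi
  refine ⟨hdec, fun k hk => ?_, fun k hk hne => ?_, fun k h1 hk => ⟨?_, ?_, ?_⟩⟩
  · by_cases hI : Interlace π (cornerCell π N p k) (cornerCell π N p (k + 1))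
    · exact Or.inr hI
    · exact Or.inl (hunion k hk hI)
  · obtain ⟨a, ha⟩ := hne
    have h1 := hs.exists_link av sp hk ha
    cases k with
    | zero =>
      have h2 : 0 ≤ N ∧ _ := h1.resolve_left fun h => absurd h.1 (by omega)
      exact Or.inr ⟨⟨h2.1, (hlink 0 h2.1).2 h2.2⟩, fun h => absurd h.1 (by omega)⟩
    | succ k =>
      rw [Nat.add_sub_cancel] at h1 ⊢
      have e1 := hlink k (by omega)
      by_cases hkN : k + 1 ≤ N
      · have e2 := hlink (k + 1) hkN
        have e3 := hs.not_link av hkN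
        rw [e1, e2]
        rcases h1 with h1 | h1
        · exact Or.inl ⟨h1, fun h2 => e3 h1.2 h2.2⟩
        · exact Or.inr ⟨h1, fun h2 => e3 h2.2 h1.2⟩
      · rcases h1 with h1 | h1
        · exact Or.inl ⟨⟨h1.1, e1.2 h1.2⟩, fun h2 => hkN h2.1⟩
        · exact absurd h1.1 hkN
  · rw [Finset.card_le_one]
    exact fun a ha b hb => hs.central_subsingleton av sp h1 hk ha hb
  · intro hI
    obtain ⟨a, b, ha, hb, hab⟩ := (hlink k hk.le).1 hI
    refine Finset.eq_empty_iff_forall_notMem.2 fun s hS => ?_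
    have i1 := hs.central_not_inc av h1 hk hS (Or.inl ha)
    have i2 := hs.central_not_inc av h1 hk hS (Or.inr (Or.inr hb))
    -- In one coordinate `s` lies between the linked entries `a` and `b`. Decreasing with both, it
    -- is in the other coordinate not after `a` and not before `b`, although `a` comes before `b`.
    by_cases hσ : IsMaxInflection π (p 1) ↔ Odd k
    · have i3 := hs.central_mem h1 hk hσ hS
      have i4 := i3.2.2.1 a ha
      have i5 := i3.2.2.2 b hb
      have i6 : ¬ xz a < xz s := fun hh => i1.2 ⟨hh, i4⟩
      have i7 : ¬ xz s < xz b := fun hh => i2.1 ⟨hh, i5⟩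
      have := hab.1
      omega
    · have i3 := hs.swap.central_mem h1 hk hσ hS
      have i4 := i3.2.2.1 a ha
      have i5 := i3.2.2.2 b hb
      have i6 : ¬ yz π a < yz π s := fun hh => i1.2 ⟨i4, hh⟩
      have i7 : ¬ yz π s < yz π b := fun hh => i2.1 ⟨i5, hh⟩
      have := hab.2
      omega
  · intro hI
    have hu := decreasing_iff.1 (hunion k hk.le hI)
    rw [decreasing_iff]
    intro a ha b hb
    have ha : a ∈ centralCell π p k ∨ a ∈ cornerCell π N p k ∪ cornerCell π N p (k + 1) := by
      simp only [Finset.mem_union] at ha ⊢; tauto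
    have hb : b ∈ centralCell π p k ∨ b ∈ cornerCell π N p k ∪ cornerCell π N p (k + 1) := by
      simp only [Finset.mem_union] at hb ⊢; tauto
    have hor : ∀ c, c ∈ centralCell π p k ∨ c ∈ cornerCell π N p k ∪ cornerCell π N p (k + 1) →
        c ∈ cornerCell π N p k ∨ c ∈ centralCell π p k ∨ c ∈ cornerCell π N p (k + 1) := by
      intro c hc
      simp only [Finset.mem_union] at hc
      tauto
    rcases ha with ha' | ha'
    · exact (hs.central_not_inc av h1 hk ha' (hor b hb)).1
    · rcases hb with hb' | hb'
      · exact (hs.central_not_inc av h1 hk hb' (hor a (Or.inr ha'))).2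
      · exact hu a ha' b hb'

end PermClass

theorem mainTheorem2 (n : ℕ) (hn : 2 < n) (π : Equiv.Perm (Fin n))
    (hπ : PermClass.IsSimple π) :
    PermClass.InAv π ↔
      ∃ (N : ℕ) (p : ℕ → ℕ × ℕ),
        PermClass.AlternatingInflections π N p ∧
        PermClass.CornersDecreasing π N p ∧
        PermClass.ConsecutiveCorners π N p ∧
        PermClass.CornersInterlaceOnce π N p ∧
        PermClass.CentralCells π N p := by
  have : Nonempty (Fin n) := ⟨⟨0, by omega⟩⟩
  have sp := hπ.simplePoints hn
  constructor
  · intro h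
    have av := (PermClass.inAv_iff_avoids π).1 h
    obtain ⟨N, p, hp⟩ := PermClass.exists_alternatingInflections sp av
    exact ⟨N, p, hp, PermClass.conditions_of_avoids sp av hp⟩
  · rintro ⟨N, p, hp, hb, hc, hd, he⟩
    exact PermClass.inAv_of_conditions sp hp hb hc hd he
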